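/- **Setting.** *Types* are the closed types of the grammar $\tau ::= \alpha \mid \mathbf 1 \mid \tau\times\tau \mid \tau+\tau \mid \langle\tau\to\tau,\Theta,\Theta_{\mathsf{cf}}\rangle \mid \mu\alpha.\,\tau$ (the sets $\Theta,\Theta_{\mathsf{cf}}$ are resource specifications, irrelevant here). An auxiliary symbol $\top_\mu$ is also allowed in the definitions below. The *values* $\mathcal V(\tau)$ are: $\mathsf{tt}\in\mathcal V(\mathbf 1)$; $\mathsf{pair}(v_1;v_2)\in\mathcal V(\tau_1\times\tau_2)$ for $v_k\in\mathcal V(\tau_k)$; $\mathsf{inl}\,v_1,\mathsf{inr}\,v_2\in\mathcal V(\tau_1+\tau_2)$; every $\mathsf{fun}(f,x.e)$ in every arrow type; $\mathsf{fold}\,v\in\mathcal V(\mu\alpha.\tau)$ for $v\in\mathcal V([\mu\alpha.\tau/\alpha]\tau)$. The *indices* $\mathcal I(\tau)$ are defined by the same clauses, with a single index $\lambda$ for every arrow type and an additional index $\mathsf{end}\in\mathcal I(\mu\alpha.\tau)$. The *annotations* $\mathcal A(\tau)$ form the free $\mathbb Q_{\ge0}$-semimodule with basis $\mathcal I(\tau)$;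 a finite set of indices is identified with the sum of its elements, and $\mathsf{inl},\mathsf{inr},\mathsf{fold},\mathsf{pair}$ and the operators below are extended (bi)linearly. *Constant indices*: $\mathcal C(\mathbf 1)=\{\mathsf{tt}\}$, $\mathcal C(\tau_1\times\tau_2)=\mathsf{pair}(\mathcal C(\tau_1);\mathcal C(\tau_2))$, $\mathcal C(\tau_1+\tau_2)=\mathsf{inl}\,\mathcal C(\tau_1)\cup\mathsf{inr}\,\mathcal C(\tau_2)$, $\mathcal C(\tau_1\to\tau_2)=\{\lambda\}$, $\mathcal C(\mu\alpha.\tau)=\mathcal C(\top_\mu)=\mathcal C(\alpha)=\{\mathsf{end}\}$. *Recursive occurrences*: $\mathcal M\{\alpha.\alpha\}(i)=\{i\}$; $\mathcal M\{\alpha.\sigma\}(i)=\emptyset$ for $\sigma=\top_\mu,\mathbf 1$ or an arrow type; $\mathcal M\{\alpha.\sigma+\rho\}(i)=\mathsf{inl}\,\mathcal M\{\alpha.\sigma\}(i)\cup\mathsf{inr}\,\mathcal M\{\alpha.\rho\}(i)$; $\mathcal M\{\alpha.\sigma\times\rho\}(i)=\mathsf{pair}(\mathcal M\{\alpha.\sigma\}(i);\mathcal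 C(\rho))\cup\mathsf{pair}(\mathcal C(\sigma);\mathcal M\{\alpha.\rho\}(i))$; $\mathcal M\{\alpha.\mu\beta.\sigma\}(i)=\mathsf{fold}\,\mathcal M\{\alpha.[\top_\mu/\beta]\sigma\}(i)$. *Evaluation*: $\phi_{\mathsf{tt}}(\mathsf{tt})=1$, $\phi_\lambda(\mathsf{fun}(f,x.e))=1$, $\phi_{\mathsf{pair}(i_1;i_2)}(\mathsf{pair}(v_1;v_2))=\phi_{i_1}(v_1)\phi_{i_2}(v_2)$, $\phi_{\mathsf{inl}\,i}(\mathsf{inl}\,v)=\phi_i(v)=\phi_{\mathsf{inr}\,i}(\mathsf{inr}\,v)$ and $0$ for mixed injections, $\phi_{\mathsf{end}}(\mathsf{fold}\,v)=1$, and at type $\mu\alpha.\tau$, $\phi_{\mathsf{fold}\,i}(\mathsf{fold}\,v)=\phi_i(v)+\sum_{k\in\mathcal M\{\alpha.\tau\}(\mathsf{fold}\,i)}\phi_k(v)$, with $i,k,v$ at type $[\mu\alpha.\tau/\alpha]\tau$. The *potential* is $\Phi(v:\langle\tau;P\rangle)=\sum_i p_i\,\phi_i(v)$, and the *resource polynomials*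 $\mathcal R(\tau)$ are the functions on $\mathcal V(\tau)$ that are $\mathbb Q_{\ge0}$-linear combinations of the $\phi_i$, $i\in\mathcal I(\tau)$. *Sharing* $\curlyvee_\tau$ is the bilinear extension of the operation on indices given, together with $\mathcal N\{\alpha[\tau].\sigma\}(i,j)$ (placing $i,j$ at two different occurrences of $\alpha$ in $\sigma$), by the following mutually recursive equations: - $\mathsf{tt}\curlyvee\mathsf{tt}=\mathsf{tt}$; $\lambda\curlyvee\lambda=\lambda$; $\mathsf{inl}\,i\curlyvee\mathsf{inl}\,j=\mathsf{inl}(i\curlyvee j)$; $\mathsf{inr}\,i\curlyvee\mathsf{inr}\,j=\mathsf{inr}(i\curlyvee j)$; $\mathsf{pair}(i_1;i_2)\curlyvee\mathsf{pair}(j_1;j_2)=\mathsf{pair}(i_1\curlyvee j_1;i_2\curlyvee j_2)$; $\mathsf{end}\curlyvee\mathsf{end}=\mathsf{end}$ (at $\mu$-types and at $\top_\mu$); $\mathsf{fold}\,i\curlyvee\mathsf{end}=\mathsf{fold}\,i$; $\mathsf{end}\curlyvee\mathsf{fold}\,j=\mathsf{fold}\,j$; at type $\mu\alpha.\tau$,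 with the merges on the right at type $[\mu\alpha.\tau/\alpha]\tau$, $$\mathsf{fold}\,i\curlyvee\mathsf{fold}\,j=\mathsf{fold}(i\curlyvee j)+\mathsf{fold}(\mathcal M\{\alpha.\tau\}(\mathsf{fold}\,i)\curlyvee j)+\mathsf{fold}(i\curlyvee\mathcal M\{\alpha.\tau\}(\mathsf{fold}\,j))+\mathsf{fold}\,\mathcal N\{\alpha[\tau].\tau\}(\mathsf{fold}\,i,\mathsf{fold}\,j);$$ and $0$ otherwise. - $\mathcal N\{\alpha[\tau].\sigma\}(i,j)=0$ if $\sigma$ is $\mathbf 1$, $\top_\mu$, $\alpha$ or an arrow type. Write $N_\sigma=\mathcal N\{\alpha[\tau].\sigma\}(i,j)$ and $M_\sigma(k)=\mathcal M\{\alpha.\sigma\}(k)$. Then $N_{\sigma+\rho}=\mathsf{inl}\,N_\sigma+\mathsf{inr}\,N_\rho$ and $N_{\sigma\times\rho}=\mathsf{pair}(N_\sigma;\mathcal C(\rho))+\mathsf{pair}(\mathcal C(\sigma);N_\rho)+\mathsf{pair}(M_\sigma(i);M_\rho(j))+\mathsf{pair}(M_\sigma(j);M_\rho(i))$. For $\sigma=\mu\beta.s$,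 put $s_0=[\top_\mu/\beta]s$, $s_1=[\mu\alpha.\tau/\alpha]s$; then $$N_{\mu\beta.s}=\mathsf{fold}\,N_{s_0}+\mathsf{fold}\big(\mathcal M\{\beta.s_1\}(\mathsf{fold}\,M_{s_0}(i))\curlyvee M_{s_0}(j)\big)+\mathsf{fold}\big(M_{s_0}(i)\curlyvee\mathcal M\{\beta.s_1\}(\mathsf{fold}\,M_{s_0}(j))\big)+\mathsf{fold}\,\mathcal N\{\beta[s_1].s_1\}(\mathsf{fold}\,M_{s_0}(i),\mathsf{fold}\,M_{s_0}(j)),$$ with merges at type $[\mu\beta.s_1/\beta]s_1$. **Theorem (Share preserves potential).** Let $\tau$ be a type. The recursion above determines $i\curlyvee_\tau j$ after finitely many steps for all $i,j\in\mathcal I(\tau)$ (that is, iterating the equations from zero becomes stationary), so that sharing is a bilinear map $\mathcal A(\tau)\times\mathcal A(\tau)\to\mathcal A(\tau)$. For all $P,Q\in\mathcal A(\tau)$ and $v\in\mathcal V(\tau)$, $$\Phi(v:\langle\tau;P\rangle)\cdot\Phi(v:\langle\tau;Q\rangle)=\Phi(v:\langle\tau;P\curlyvee_\tau Q\rangle).$$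 In particular, $\mathcal R(\tau)$ is closed under multiplication. -/

import Mathlib

namespace AARA

/-! ### Indices and annotations -/

/-- Raw base polynomial indices: `tt`, `pair(i; j)`, `inl i`, `inr i`, `λ` (for arrow types),
`fold i` and `end` (called `ending`).  Which of them are indices *for a type* is `HasIdx` below. -/
inductive Idx : Type where
  | tt : Idx
  | pair : Idx → Idx → Idx
  | inl : Idx → Idx
  | inr : Idx → Idx
  | lam : Idx
  | fold : Idx → Idx
  | ending : Idx
  deriving DecidableEq

/-- Finite formal combinations of raw indices with nonnegative rational coefficients.
The annotations for a type are the submodule `annotations` below. -/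
abbrev Ann : Type := Idx →₀ ℚ≥0

/-! ### Types -/

/-- Types in de Bruijn notation: `mu t` is `μα. t`, where `var 0` in `t` is the bound `α`.
`top` is the auxiliary piece of syntax `⊤_μ`; it does not occur in proper types (`Ty.IsProper`).
An arrow type carries its two resource specifications `Θ`, `Θ_cf`: sets of pairs of annotations.
They play no role for potentials; no restriction on them is imposed. -/
inductive Ty : Type where
  | var : ℕ → Ty
  | top : Ty
  | unit : Ty
  | prod : Ty → Ty → Ty
  | sum : Ty → Ty → Ty
  | arrow : Ty → Ty → Set (Ann × Ann) → Set (Ann × Ann) → Ty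
  | mu : Ty → Ty

namespace Ty

/-- `t.Scoped k`: `t` is built without `⊤_μ`, and its free variables are among `var 0, …,
var (k - 1)`. -/
def Scoped : ℕ → Ty → Prop
  | k, var n => n < k
  | _, top => False
  | _, unit => True
  | k, prod a b => Scoped k a ∧ Scoped k b
  | k, sum a b => Scoped k a ∧ Scoped k b
  | k, arrow a b _ _ => Scoped k a ∧ Scoped k b
  | k, mu t => Scoped (k + 1) t

/-- Proper types: closed types of the grammar (without `⊤_μ`). -/
def IsProper (t : Ty) : Prop := Scoped 0 t

/-- `t.inst k s` is the capture-avoiding substitution `[s/α]t`, where `α` is the variable with de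
Bruijn index `k` in `t`.  The type `s` has no free variables wherever this is used, so it need not
be shifted under binders.  Resource specifications consist of raw annotations, in which no type
occurs. -/
def inst : Ty → ℕ → Ty → Ty
  | var n, k, s => if n < k then var n else if n = k then s else var (n - 1)
  | top, _, _ => top
  | unit, _, _ => unit
  | prod a b, k, s => prod (a.inst k s) (b.inst k s)
  | sum a b, k, s => sum (a.inst k s) (b.inst k s)
  | arrow a b Θ Θcf, k, s => arrow (a.inst k s) (b.inst k s) Θ Θcf
  | mu t, k, s => mu (t.inst (k + 1) s)

/-- The unfolding `[μα.t/α]t` of `μα.t`. -/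
def unfold (t : Ty) : Ty := t.inst 0 (mu t)

/-- Number of constructors; used only to see that `recIdx` is well defined. -/
def size : Ty → ℕ
  | var _ => 1
  | top => 1
  | unit => 1
  | prod a b => size a + size b + 1
  | sum a b => size a + size b + 1
  | arrow a b _ _ => size a + size b + 1
  | mu t => size t + 1

theorem size_inst_top (t : Ty) : ∀ k, (t.inst k top).size = t.size := by
  induction t with
  | var n => intro k; simp only [inst]; split_ifs <;> rfl
  | top => intro k; rfl
  | unit => intro k; rfl
  | prod a b iha ihb => intro k; simp [inst, size, iha, ihb]
  | sum a b iha ihb => intro k; simp [inst, size, iha, ihb]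
  | arrow a b _ _ iha ihb => intro k; simp [inst, size, iha, ihb]
  | mu t ih => intro k; simp [inst, size, ih]

end Ty

/-! ### Values -/

/-- Expressions of the language (with de Bruijn variables).  They only occur as bodies of function
values: `func e` is `fun(f, x. e)` and binds two variables, `casep` binds two, `letin` and each
branch of `cases` one. -/
inductive Exp : Type where
  | var : ℕ → Exp
  | tt : Exp
  | pair : Exp → Exp → Exp
  | inl : Exp → Exp
  | inr : Exp → Exp
  | fold : Exp → Exp
  | unfold : Exp → Exp
  | func : Exp → Exp
  | tick : ℚ → Exp
  | letin : Exp → Exp → Exp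
  | cases : Exp → Exp → Exp → Exp
  | casep : Exp → Exp → Exp
  | app : Exp → Exp → Exp

/-- Values. -/
inductive Val : Type where
  | tt : Val
  | pair : Val → Val → Val
  | inl : Val → Val
  | inr : Val → Val
  | func : Exp → Val
  | fold : Val → Val

/-- `HasVal τ v` is `v ∈ 𝒱(τ)`. -/
inductive HasVal : Ty → Val → Prop where
  | tt : HasVal .unit .tt
  | pair {a b : Ty} {v w : Val} : HasVal a v → HasVal b w → HasVal (.prod a b) (.pair v w)
  | inl {a b : Ty} {v : Val} : HasVal a v → HasVal (.sum a b) (.inl v)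
  | inr {a b : Ty} {v : Val} : HasVal b v → HasVal (.sum a b) (.inr v)
  | func {a b : Ty} {Θ Θcf : Set (Ann × Ann)} {e : Exp} : HasVal (.arrow a b Θ Θcf) (.func e)
  | fold {t : Ty} {v : Val} : HasVal t.unfold v → HasVal (.mu t) (.fold v)

/-- `HasIdx τ i` is `i ∈ ℐ(τ)`. -/
inductive HasIdx : Ty → Idx → Prop where
  | tt : HasIdx .unit .tt
  | pair {a b : Ty} {i j : Idx} : HasIdx a i → HasIdx b j → HasIdx (.prod a b) (.pair i j)
  | inl {a b : Ty} {i : Idx} : HasIdx a i → HasIdx (.sum a b) (.inl i)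
  | inr {a b : Ty} {i : Idx} : HasIdx b i → HasIdx (.sum a b) (.inr i)
  | lam {a b : Ty} {Θ Θcf : Set (Ann × Ann)} : HasIdx (.arrow a b Θ Θcf) .lam
  | fold {t : Ty} {i : Idx} : HasIdx t.unfold i → HasIdx (.mu t) (.fold i)
  | ending {t : Ty} : HasIdx (.mu t) .ending

/-- `𝒜(τ)`: the free `ℚ≥0`-semimodule with basis `ℐ(τ)`. -/
noncomputable def annotations (τ : Ty) : Submodule ℚ≥0 Ann :=
  Finsupp.supported ℚ≥0 ℚ≥0 {i | HasIdx τ i}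

/-! ### Index sets and evaluation -/

/-- The constant index set `𝒞(τ)`.  A type variable stands for a recursive type, so its constant
index is `end`. -/
def constIdx : Ty → Finset Idx
  | .var _ => {.ending}
  | .top => {.ending}
  | .unit => {.tt}
  | .prod a b => (constIdx a ×ˢ constIdx b).image fun p => .pair p.1 p.2
  | .sum a b => (constIdx a).image .inl ∪ (constIdx b).image .inr
  | .arrow _ _ _ _ => {.lam}
  | .mu _ => {.ending}

/-- The recursive occurrence index set `ℳ{α.τ}(i)`, where `α` is `var 0`. -/
def recIdx : Ty → Idx → Finset Idx
  | .var 0, i => {i}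
  | .var (_ + 1), _ => ∅
  | .top, _ => ∅
  | .unit, _ => ∅
  | .prod a b, i =>
      ((recIdx a i ×ˢ constIdx b).image fun p => .pair p.1 p.2) ∪
      ((constIdx a ×ˢ recIdx b i).image fun p => .pair p.1 p.2)
  | .sum a b, i => (recIdx a i).image .inl ∪ (recIdx b i).image .inr
  | .arrow _ _ _ _, _ => ∅
  | .mu t, i => (recIdx (t.inst 0 .top) i).image .fold
termination_by τ => τ.size
decreasing_by all_goals simp only [Ty.size, Ty.size_inst_top]; omega

/-- Base polynomial evaluation `φ_i(v : τ)`. -/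
def phi : Val → Ty → Idx → ℚ≥0
  | .tt, .unit, .tt => 1
  | .pair v w, .prod a b, .pair i j => phi v a i * phi w b j
  | .inl v, .sum a _, .inl i => phi v a i
  | .inr w, .sum _ b, .inr j => phi w b j
  | .func _, .arrow _ _ _ _, .lam => 1
  | .fold v, .mu t, .fold i => phi v t.unfold i + ∑ k ∈ recIdx t (.fold i), phi v t.unfold k
  | .fold _, .mu _, .ending => 1
  | _, _, _ => 0

/-- The potential `Φ(v : ⟨τ; P⟩) = ∑ᵢ pᵢ · φᵢ(v : τ)`. -/
noncomputable def potential (τ : Ty) (P : Ann) (v : Val) : ℚ≥0 :=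
  P.sum fun i p => p * phi v τ i

/-- The resource polynomials `ℛ(τ)`: the functions on `𝒱(τ)` that are linear combinations of base
polynomials with nonnegative rational coefficients. -/
noncomputable def resourcePolynomials (τ : Ty) : Submodule ℚ≥0 ({v : Val // HasVal τ v} → ℚ≥0) :=
  Submodule.span ℚ≥0 {f | ∃ i, HasIdx τ i ∧ f = fun v => phi v.1 τ i}

/-! ### Linear operations on annotations -/

/-- A finite set of indices as an annotation. -/
noncomputable def ofSet (B : Finset Idx) : Ann := ∑ i ∈ B, Finsupp.single i 1

/-- Linear extension of a map on indices. -/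
noncomputable def linExt (f : Idx → Ann) : Ann →ₗ[ℚ≥0] Ann := Finsupp.linearCombination ℚ≥0 f

/-- Bilinear extension of a map on pairs of indices. -/
noncomputable def bilinExt (f : Idx → Idx → Ann) : Ann →ₗ[ℚ≥0] Ann →ₗ[ℚ≥0] Ann :=
  Finsupp.linearCombination ℚ≥0 fun i => linExt (f i)

noncomputable def inlA : Ann →ₗ[ℚ≥0] Ann := linExt fun i => .single (.inl i) 1

noncomputable def inrA : Ann →ₗ[ℚ≥0] Ann := linExt fun i => .single (.inr i) 1

noncomputable def foldA : Ann →ₗ[ℚ≥0] Ann := linExt fun i => .single (.fold i) 1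

noncomputable def pairA : Ann →ₗ[ℚ≥0] Ann →ₗ[ℚ≥0] Ann :=
  bilinExt fun i j => .single (.pair i j) 1

/-- `ℳ{α.τ}` as a linear map on annotations. -/
noncomputable def recA (τ : Ty) : Ann →ₗ[ℚ≥0] Ann := linExt fun i => ofSet (recIdx τ i)

/-! ### Sharing

The operators `i ⋎_τ j` (merge) and `𝒩{α[τ].σ}(i, j)` are given by a mutually recursive system of
equations.  `mergeRhs` and `twoRhs` are the right-hand sides of these equations, for given values
`m` of the merge and `N` of the `𝒩` operator at the recursive calls. -/

/-- Right-hand side of the equations for `i ⋎_τ j`. -/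
noncomputable def mergeRhs (m : Ty → Idx → Idx → Ann) (N : Ty → Ty → Idx → Idx → Ann) :
    Ty → Idx → Idx → Ann
  | .unit, .tt, .tt => .single .tt 1
  | .arrow _ _ _ _, .lam, .lam => .single .lam 1
  | .sum a _, .inl i, .inl j => inlA (m a i j)
  | .sum _ b, .inr i, .inr j => inrA (m b i j)
  | .prod a b, .pair i₁ i₂, .pair j₁ j₂ => pairA (m a i₁ j₁) (m b i₂ j₂)
  | .top, .ending, .ending => .single .ending 1
  | .mu _, .ending, .ending => .single .ending 1
  | .mu _, .fold i, .ending => .single (.fold i) 1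
  | .mu _, .ending, .fold j => .single (.fold j) 1
  | .mu t, .fold i, .fold j =>
      foldA (m t.unfold i j) +
      foldA (bilinExt (m t.unfold) (ofSet (recIdx t (.fold i))) (.single j 1)) +
      foldA (bilinExt (m t.unfold) (.single i 1) (ofSet (recIdx t (.fold j)))) +
      foldA (N t t (.fold i) (.fold j))
  | _, _, _ => 0

/-- Right-hand side of the equations for `𝒩{α[τ].σ}(i, j)`, where `var 0` of `τ` and of `σ` is `α`,
and `i`, `j` are indices for `μα.τ`: the indices `i` and `j` are placed at two *different*
occurrences of `α` in `σ`.  In the case `σ = μβ.s` (so `var 0` is `β` and `var 1` is `α` in `s`),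
`s₀` is `[⊤_μ/β]s` and `s₁` is `[μα.τ/α]s`. -/
noncomputable def twoRhs (m : Ty → Idx → Idx → Ann) (N : Ty → Ty → Idx → Idx → Ann)
    (τ : Ty) : Ty → Idx → Idx → Ann
  | .var _, _, _ => 0
  | .top, _, _ => 0
  | .unit, _, _ => 0
  | .arrow _ _ _ _, _, _ => 0
  | .sum a b, i, j => inlA (N τ a i j) + inrA (N τ b i j)
  | .prod a b, i, j =>
      pairA (N τ a i j) (ofSet (constIdx b)) + pairA (ofSet (constIdx a)) (N τ b i j) +
      pairA (ofSet (recIdx a i)) (ofSet (recIdx b j)) +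
      pairA (ofSet (recIdx a j)) (ofSet (recIdx b i))
  | .mu s, i, j =>
      let s₀ := s.inst 0 .top
      let s₁ := s.inst 1 (.mu τ)
      let Mi := ofSet (recIdx s₀ i)
      let Mj := ofSet (recIdx s₀ j)
      foldA (N τ s₀ i j) +
      foldA (bilinExt (m s₁.unfold) (recA s₁ (foldA Mi)) Mj) +
      foldA (bilinExt (m s₁.unfold) Mi (recA s₁ (foldA Mj))) +
      foldA (bilinExt (N s₁ s₁) (foldA Mi) (foldA Mj))

/-- The `n`-th iterate, starting from zero, of the system of equations for merge and `𝒩`. -/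
noncomputable def iter : ℕ → (Ty → Idx → Idx → Ann) × (Ty → Ty → Idx → Idx → Ann)
  | 0 => (fun _ _ _ => 0, fun _ _ _ _ => 0)
  | n + 1 => (mergeRhs (iter n).1 (iter n).2, twoRhs (iter n).1 (iter n).2)

open Classical in
/-- The merge `i ⋎_τ j` on indices, as computed by the recursive equations: the value at which the
iterates become stationary.  (For `i, j ∈ ℐ(τ)` there is such a value; this is part of the
theorem.) -/
noncomputable def merge (τ : Ty) (i j : Idx) : Ann :=
  if h : ∃ R : Ann, ∀ᶠ n in Filter.atTop, (iter n).1 τ i j = R then h.choose else 0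

/-- The sharing operator `P ⋎_τ Q`: the bilinear extension of the merge of indices. -/
noncomputable def share (τ : Ty) : Ann →ₗ[ℚ≥0] Ann →ₗ[ℚ≥0] Ann := bilinExt (merge τ)

end AARA

/-! Two things are needed: the recursion stops, and its value is right. Both are proved for closed
types in which `⊤_μ` may occur, because the equation for `𝒩` at `μβ.s` passes through `[⊤_μ/β]s`;
proper types are a special case.

Stopping. Unfolding makes types grow, so the induction runs on open syntax `σ`, whose instances are
all the types that are met (`stable_sub`). Two indices for an instance of `σ` can be merged as soon
as the indices at equal variables, their leaves, can. The unfolding of an instance of `μβ.s` is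
again an instance of `s`, and the leaves at `β` are merged by an inner induction on the total size
of the two indices. The sets `ℳ` do no harm: by `leaf_recIdx`, a member of `ℳ{α.τ}(fold i)` has only
the leaves `fold i`, at `α`, and `end`. Putting back `fold i` costs nothing, since the other
argument has lost its outer `fold`. In the equation for `𝒩` at `μβ.s`, the nontrivial leaves of the
two merged indices sit at different variables, `β` and `α`, so each pair of leaves contains an `end`
and merges at once.

Correctness. Strong induction on the size of a value `v` gives two statements together: `MergeAt v`,
merging multiplies potentials at `v`; and `TwoAt v`, which reads `ℳ(i) · ℳ(j) = 𝒩(i, j) + ℳ(i ⋎ j)`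
at `v`: two occurrences of `α`, chosen independently, are different or equal. At `fold v`, the
polynomial of `fold i` is that of `i` plus that of `ℳ(fold i)`, both at `v`. In the product of two
such sums, three terms are handled by `MergeAt v` and the fourth by `TwoAt v`; the result is the
equation for `fold i ⋎ fold j`. For `TwoAt v` at `μβ.s`, `MergeAt v` at the same value expands `ℳ ·
ℳ` into four terms, three of which are summands of `𝒩`. The fourth, `fold (ℳ_{s₀}(i) ⋎ ℳ_{s₀}(j))`,
is rewritten by `TwoAt` at smaller values, which suffices by `Psi_fold_congr`. -/

namespace AARA

/-! ### Closed types and instantiation -/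

namespace Ty

/-- Free variables are among `var 0, …, var (k - 1)`; `⊤_μ` may occur. -/
def Closed : ℕ → Ty → Prop
  | k, var n => n < k
  | _, top => True
  | _, unit => True
  | k, prod a b => Closed k a ∧ Closed k b
  | k, sum a b => Closed k a ∧ Closed k b
  | k, arrow a b _ _ => Closed k a ∧ Closed k b
  | k, mu t => Closed (k + 1) t

theorem Scoped.closed {t : Ty} : ∀ {k : ℕ}, t.Scoped k → t.Closed k := by
  induction t with
  | var n => intro k h; exact h
  | top => intro k h; trivial
  | unit => intro k h; trivial
  | prod a b iha ihb => intro k h; exact ⟨iha h.1, ihb h.2⟩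
  | sum a b iha ihb => intro k h; exact ⟨iha h.1, ihb h.2⟩
  | arrow a b _ _ iha ihb => intro k h; exact ⟨iha h.1, ihb h.2⟩
  | mu t ih => intro k h; exact ih h

theorem Closed.mono {t : Ty} : ∀ {k l : ℕ}, t.Closed k → k ≤ l → t.Closed l := by
  induction t with
  | var n => intro k l h hl; exact lt_of_lt_of_le h hl
  | top => intros; trivial
  | unit => intros; trivial
  | prod a b iha ihb => intro k l h hl; exact ⟨iha h.1 hl, ihb h.2 hl⟩
  | sum a b iha ihb => intro k l h hl; exact ⟨iha h.1 hl, ihb h.2 hl⟩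
  | arrow a b _ _ iha ihb => intro k l h hl; exact ⟨iha h.1 hl, ihb h.2 hl⟩
  | mu t ih => intro k l h hl; exact ih h (Nat.succ_le_succ hl)

theorem Closed.inst_eq {t : Ty} (u : Ty) :
    ∀ {k j : ℕ}, t.Closed k → k ≤ j → t.inst j u = t := by
  induction t with
  | var n => intro k j h hj; simp only [Closed] at h; simp only [inst]; rw [if_pos (by omega)]
  | top => intros; rfl
  | unit => intros; rfl
  | prod a b iha ihb => intro k j h hj; simp [inst, iha h.1 hj, ihb h.2 hj]
  | sum a b iha ihb => intro k j h hj; simp [inst, iha h.1 hj, ihb h.2 hj]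
  | arrow a b _ _ iha ihb => intro k j h hj; simp [inst, iha h.1 hj, ihb h.2 hj]
  | mu t ih => intro k j h hj; simp [inst, ih h (Nat.succ_le_succ hj)]

theorem Closed.inst {t u : Ty} (hu : u.Closed 0) :
    ∀ {k j : ℕ}, t.Closed (k + 1) → j ≤ k → (t.inst j u).Closed k := by
  induction t with
  | var n =>
    intro k j h hj
    simp only [Closed] at h
    simp only [Ty.inst]
    split_ifs
    · simp only [Closed]; omega
    · exact hu.mono (Nat.zero_le _)
    · simp only [Closed]; omega
  | top => intros; trivial
  | unit => intros; trivial
  | prod a b iha ihb => intro k j h hj; exact ⟨iha h.1 hj, ihb h.2 hj⟩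
  | sum a b iha ihb => intro k j h hj; exact ⟨iha h.1 hj, ihb h.2 hj⟩
  | arrow a b _ _ iha ihb => intro k j h hj; exact ⟨iha h.1 hj, ihb h.2 hj⟩
  | mu t ih => intro k j h hj; exact ih h (Nat.succ_le_succ hj)

theorem Scoped.mono {t : Ty} : ∀ {k l : ℕ}, t.Scoped k → k ≤ l → t.Scoped l := by
  induction t with
  | var n => intro k l h hl; exact lt_of_lt_of_le h hl
  | top => intro k l h; exact h.elim
  | unit => intros; trivial
  | prod a b iha ihb => intro k l h hl; exact ⟨iha h.1 hl, ihb h.2 hl⟩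
  | sum a b iha ihb => intro k l h hl; exact ⟨iha h.1 hl, ihb h.2 hl⟩
  | arrow a b _ _ iha ihb => intro k l h hl; exact ⟨iha h.1 hl, ihb h.2 hl⟩
  | mu t ih => intro k l h hl; exact ih h (Nat.succ_le_succ hl)

theorem Scoped.inst {t u : Ty} (hu : u.Scoped 0) :
    ∀ {k j : ℕ}, t.Scoped (k + 1) → j ≤ k → (t.inst j u).Scoped k := by
  induction t with
  | var n =>
    intro k j h hj
    simp only [Scoped] at h
    simp only [Ty.inst]
    split_ifs
    · simp only [Scoped]; omega
    · exact hu.mono (Nat.zero_le _)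
    · simp only [Scoped]; omega
  | top => intro k j h; exact h.elim
  | unit => intros; trivial
  | prod a b iha ihb => intro k j h hj; exact ⟨iha h.1 hj, ihb h.2 hj⟩
  | sum a b iha ihb => intro k j h hj; exact ⟨iha h.1 hj, ihb h.2 hj⟩
  | arrow a b _ _ iha ihb => intro k j h hj; exact ⟨iha h.1 hj, ihb h.2 hj⟩
  | mu t ih => intro k j h hj; exact ih h (Nat.succ_le_succ hj)

/-! ### Simultaneous substitution -/

/-- Closed types that a type variable may stand for: recursive types and `⊤_μ`. -/
def Good (r : Ty) : Prop := r.Closed 0 ∧ (r = top ∨ ∃ t, r = mu t)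

/-- Entries of the substitutions used here: variables and good types. -/
def Entry (k : ℕ) (r : Ty) : Prop := (∃ n, n < k ∧ r = var n) ∨ r.Good

/-- Weakening of an entry under one binder. -/
def shift : Ty → Ty
  | var n => var (n + 1)
  | t => t

/-- Extension of a substitution by a new entry for `var 0`. -/
def cons (u : Ty) (ρ : ℕ → Ty) : ℕ → Ty
  | 0 => u
  | n + 1 => ρ n

/-- A substitution under one binder. -/
def lift (ρ : ℕ → Ty) : ℕ → Ty := cons (var 0) fun n => shift (ρ n)

/-- Simultaneous substitution. -/
def sub : Ty → (ℕ → Ty) → Ty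
  | var n, ρ => ρ n
  | top, _ => top
  | unit, _ => unit
  | prod a b, ρ => prod (a.sub ρ) (b.sub ρ)
  | sum a b, ρ => sum (a.sub ρ) (b.sub ρ)
  | arrow a b Θ Θcf, ρ => arrow (a.sub ρ) (b.sub ρ) Θ Θcf
  | mu t, ρ => mu (t.sub (lift ρ))


theorem good_top : Good top := ⟨trivial, .inl rfl⟩

theorem good_mu {t : Ty} (h : t.Closed 1) : Good (mu t) := ⟨h, .inr ⟨t, rfl⟩⟩

theorem Good.shift_eq {r : Ty} (h : r.Good) : r.shift = r := by
  obtain ⟨-, rfl | ⟨t, rfl⟩⟩ := h <;> rfl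

theorem Entry.shift {r : Ty} {k : ℕ} (h : r.Entry k) : r.shift.Entry (k + 1) := by
  rcases h with ⟨n, hn, rfl⟩ | h
  · exact .inl ⟨n + 1, by omega, rfl⟩
  · rw [h.shift_eq]; exact .inr h

theorem entry_cons {u : Ty} {ρ : ℕ → Ty} {k : ℕ} (hu : u.Entry k) (hρ : ∀ n, (ρ n).Entry k)
    (n : ℕ) : (cons u ρ n).Entry k := by
  cases n with
  | zero => exact hu
  | succ n => exact hρ n

theorem entry_lift {ρ : ℕ → Ty} {k : ℕ} (hρ : ∀ n, (ρ n).Entry k) (n : ℕ) :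
    (lift ρ n).Entry (k + 1) := by
  cases n with
  | zero => exact .inl ⟨0, by omega, rfl⟩
  | succ n => exact (hρ n).shift

theorem Entry.closed {r : Ty} {k : ℕ} (h : r.Entry k) : r.Closed k := by
  rcases h with ⟨n, hn, rfl⟩ | h
  · exact hn
  · exact h.1.mono (Nat.zero_le _)

theorem closed_sub (σ : Ty) : ∀ {k : ℕ} {ρ : ℕ → Ty}, (∀ n, (ρ n).Entry k) →
    (σ.sub ρ).Closed k := by
  induction σ with
  | var n => intro k ρ h; exact (h n).closed
  | top => intros; trivial
  | unit => intros; trivial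
  | prod a b iha ihb => intro k ρ h; exact ⟨iha h, ihb h⟩
  | sum a b iha ihb => intro k ρ h; exact ⟨iha h, ihb h⟩
  | arrow a b _ _ iha ihb => intro k ρ h; exact ⟨iha h, ihb h⟩
  | mu t ih => intro k ρ h; exact ih (entry_lift h)

theorem Entry.shift_inst {r u : Ty} {K : ℕ} (h : r.Entry K) (hu : u.Good) (k : ℕ) :
    r.shift.inst (k + 1) u = (r.inst k u).shift := by
  rcases h with ⟨n, -, rfl⟩ | h
  · simp only [Ty.shift, inst]
    rcases lt_trichotomy n k with hn | rfl | hn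
    · simp [hn]
    · simp only [lt_irrefl, if_false, if_true]; exact hu.shift_eq.symm
    · have h1 : ¬ n < k := by omega
      have h2 : n ≠ k := by omega
      simp only [add_lt_add_iff_right, h1, if_false, add_left_inj, h2]
      congr 1; omega
  · rw [h.shift_eq, h.1.inst_eq u (Nat.zero_le _), h.1.inst_eq u (Nat.zero_le _), h.shift_eq]

theorem sub_inst (s : Ty) {u : Ty} (hu : u.Good) : ∀ {K : ℕ} {ρ : ℕ → Ty} (k : ℕ),
    (∀ n, (ρ n).Entry K) → (s.sub ρ).inst k u = s.sub fun n => (ρ n).inst k u := by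
  induction s with
  | var n => intros; rfl
  | top => intros; rfl
  | unit => intros; rfl
  | prod a b iha ihb => intro K ρ k h; simp only [sub, inst, iha k h, ihb k h]
  | sum a b iha ihb => intro K ρ k h; simp only [sub, inst, iha k h, ihb k h]
  | arrow a b _ _ iha ihb => intro K ρ k h; simp only [sub, inst, iha k h, ihb k h]
  | mu t ih =>
    intro K ρ k h
    simp only [sub, inst, ih (k + 1) (entry_lift h)]
    congr 2
    funext n
    cases n with
    | zero => simp [lift, cons, inst]
    | succ n => exact (h n).shift_inst hu k

theorem Entry.shift_inst_zero {r u : Ty} {K : ℕ} (h : r.Entry K) : r.shift.inst 0 u = r := by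
  rcases h with ⟨n, -, rfl⟩ | h
  · simp [Ty.shift, inst]
  · rw [h.shift_eq, h.1.inst_eq u le_rfl]

/-- Consequently the unfolding of an instance of `mu s` is an instance of `s` itself, under a longer
substitution. This lets inductions on syntax survive unfolding. -/
theorem sub_lift_inst (s : Ty) {u : Ty} (hu : u.Good) {K : ℕ} {ρ : ℕ → Ty}
    (h : ∀ n, (ρ n).Entry K) : (s.sub (lift ρ)).inst 0 u = s.sub (cons u ρ) := by
  rw [sub_inst s hu 0 (entry_lift h)]
  congr 1
  funext n
  cases n with
  | zero => rfl
  | succ n => exact (h n).shift_inst_zero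

theorem sub_eq_self (s : Ty) : ∀ {k : ℕ} {ρ : ℕ → Ty}, s.Closed k → (∀ n < k, ρ n = var n) →
    s.sub ρ = s := by
  induction s with
  | var n => intro k ρ h hρ; exact hρ n h
  | top => intros; rfl
  | unit => intros; rfl
  | prod a b iha ihb => intro k ρ h hρ; simp only [sub, iha h.1 hρ, ihb h.2 hρ]
  | sum a b iha ihb => intro k ρ h hρ; simp only [sub, iha h.1 hρ, ihb h.2 hρ]
  | arrow a b _ _ iha ihb => intro k ρ h hρ; simp only [sub, iha h.1 hρ, ihb h.2 hρ]
  | mu t ih =>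
    intro k ρ h hρ
    simp only [sub]
    rw [ih h]
    intro n hn
    cases n with
    | zero => rfl
    | succ n =>
      change (ρ n).shift = _
      rw [hρ n (by omega)]; rfl

/-- The substitution by `⊤_μ` everywhere. -/
def tops : ℕ → Ty := fun _ => top

theorem sub_tops {s : Ty} (h : s.Closed 0) : s.sub tops = s :=
  sub_eq_self s h fun n hn => absurd hn (Nat.not_lt_zero n)

theorem sub_var_tops {s : Ty} (h : s.Closed 1) : s.sub (cons (var 0) tops) = s :=
  sub_eq_self s h fun n hn => by interval_cases n; rfl

theorem sub_var_var_tops {s : Ty} (h : s.Closed 2) :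
    s.sub (cons (var 0) (cons (var 1) tops)) = s :=
  sub_eq_self s h fun n hn => by interval_cases n <;> rfl

theorem entry_tops {k : ℕ} (n : ℕ) : (tops n).Entry k := .inr good_top

/-- With `inst_one_inst_zero`, both orders of instantiation become one simultaneous substitution.
The types built from `s₀` and from `s₁` in the equation for `𝒩` then differ only in the entry for
`var 0`. -/
theorem inst_zero_inst_zero {s a b : Ty} (h : s.Closed 2) (ha : a.Good) (hb : b.Good) :
    (s.inst 0 a).inst 0 b = s.sub (cons a (cons b tops)) := by
  have e2 : ∀ n, (cons (var 0) (cons (var 1) tops) n).Entry 2 :=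
    entry_cons (.inl ⟨0, by omega, rfl⟩) (entry_cons (.inl ⟨1, by omega, rfl⟩) entry_tops)
  conv_lhs => rw [← sub_var_var_tops h]
  rw [sub_inst s ha 0 e2, sub_inst s (K := 1) hb 0]
  · congr 1
    funext n
    rcases n with _ | _ | n
    · exact ha.1.inst_eq b le_rfl
    · rfl
    · rfl
  · rintro (_ | _ | n)
    · exact .inr ha
    · exact .inl ⟨0, by omega, rfl⟩
    · exact .inr good_top

theorem inst_one_inst_zero {s a b : Ty} (h : s.Closed 2) (ha : a.Good) (hb : b.Good) :
    (s.inst 1 b).inst 0 a = s.sub (cons a (cons b tops)) := by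
  have e2 : ∀ n, (cons (var 0) (cons (var 1) tops) n).Entry 2 :=
    entry_cons (.inl ⟨0, by omega, rfl⟩) (entry_cons (.inl ⟨1, by omega, rfl⟩) entry_tops)
  conv_lhs => rw [← sub_var_var_tops h]
  rw [sub_inst s hb 1 e2, sub_inst s (K := 1) ha 0]
  · congr 1
    funext n
    rcases n with _ | _ | n
    · rfl
    · exact hb.1.inst_eq a le_rfl
    · rfl
  · rintro (_ | _ | n)
    · exact .inl ⟨0, by omega, rfl⟩
    · exact .inr hb
    · exact .inr good_top

end Ty

/-! ### Index sets under a change of substitution -/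

open Ty Filter

/-- Two entries are the same variable or both good. -/
def Ty.Alike (r r' : Ty) : Prop := (∃ n, r = var n ∧ r' = var n) ∨ (r.Good ∧ r'.Good)

theorem Ty.Alike.shift {r r' : Ty} (h : r.Alike r') : r.shift.Alike r'.shift := by
  rcases h with ⟨n, rfl, rfl⟩ | ⟨h, h'⟩
  · exact .inl ⟨n + 1, rfl, rfl⟩
  · rw [h.shift_eq, h'.shift_eq]; exact .inr ⟨h, h'⟩

theorem constIdx_good {r : Ty} (h : r.Good) : constIdx r = {.ending} := by
  obtain ⟨-, rfl | ⟨t, rfl⟩⟩ := h <;> rfl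

/-- The induction is on size because `recIdx` at `mu t` goes to `t.inst 0 top`, which is no subterm
but has the size of `t`. -/
theorem recIdx_closed {t : Ty} (h : t.Closed 0) (i : Idx) : recIdx t i = ∅ := by
  induction hn : t.size using Nat.strong_induction_on generalizing t with
  | _ n ih =>
    subst hn
    cases t with
    | var n => exact absurd h (Nat.not_lt_zero n)
    | top => simp [recIdx]
    | unit => simp [recIdx]
    | arrow a b _ _ => simp [recIdx]
    | prod a b =>
      rw [recIdx, ih a.size (by simp only [size]; omega) h.1 rfl,
        ih b.size (by simp only [size]; omega) h.2 rfl]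
      simp
    | sum a b =>
      rw [recIdx, ih a.size (by simp only [size]; omega) h.1 rfl,
        ih b.size (by simp only [size]; omega) h.2 rfl]
      simp
    | mu t =>
      rw [recIdx, ih (t.inst 0 top).size (by simp only [size, size_inst_top]; omega)
        (Closed.inst good_top.1 h le_rfl) rfl]
      simp

/-- All good types have the constant set `{end}` and no recursive occurrences, so neither `constIdx`
nor `recIdx` can tell which of them replaces a variable. -/
theorem constIdx_sub_congr (σ : Ty) {ρ ρ' : ℕ → Ty} (h : ∀ n, (ρ n).Alike (ρ' n)) :
    constIdx (σ.sub ρ) = constIdx (σ.sub ρ') := by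
  induction σ with
  | var n =>
    simp only [sub]
    rcases h n with ⟨m, h, h'⟩ | ⟨h, h'⟩
    · rw [h, h']
    · rw [constIdx_good h, constIdx_good h']
  | top => rfl
  | unit => rfl
  | prod a b iha ihb => simp only [sub, constIdx, iha, ihb]
  | sum a b iha ihb => simp only [sub, constIdx, iha, ihb]
  | arrow a b _ _ => rfl
  | mu t => rfl

theorem recIdx_sub_congr (σ : Ty) (i : Idx) : ∀ {K : ℕ} {ρ ρ' : ℕ → Ty},
    (∀ n, (ρ n).Entry K) → (∀ n, (ρ' n).Entry K) → (∀ n, (ρ n).Alike (ρ' n)) →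
    recIdx (σ.sub ρ) i = recIdx (σ.sub ρ') i := by
  induction σ with
  | var n =>
    intro K ρ ρ' _ _ h
    simp only [sub]
    rcases h n with ⟨m, h, h'⟩ | ⟨h, h'⟩
    · rw [h, h']
    · rw [recIdx_closed h.1, recIdx_closed h'.1]
  | top => intros; rfl
  | unit => intros; rfl
  | prod a b iha ihb =>
    intro K ρ ρ' e e' h
    simp only [sub, recIdx, iha e e' h, ihb e e' h, constIdx_sub_congr a h,
      constIdx_sub_congr b h]
  | sum a b iha ihb => intro K ρ ρ' e e' h; simp only [sub, recIdx, iha e e' h, ihb e e' h]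
  | arrow a b _ _ => intros; simp only [sub, recIdx]
  | mu t ih =>
    intro K ρ ρ' e e' h
    simp only [sub, recIdx]
    rw [sub_lift_inst t good_top e, sub_lift_inst t good_top e',
      ih (entry_cons (.inr good_top) e) (entry_cons (.inr good_top) e')]
    rintro (_ | n)
    · exact .inr ⟨good_top, good_top⟩
    · exact h n

/-! ### Linear operations -/

theorem bilinExt_apply (f : Idx → Idx → Ann) (P Q : Ann) :
    bilinExt f P Q = P.sum fun i p => p • Q.sum fun j q => q • f i j := by
  simp only [bilinExt, linExt, Finsupp.linearCombination_apply, Finsupp.sum, LinearMap.sum_apply,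
    LinearMap.smul_apply]

theorem bilinExt_congr {f g : Idx → Idx → Ann} {P Q : Ann}
    (h : ∀ i ∈ P.support, ∀ j ∈ Q.support, f i j = g i j) : bilinExt f P Q = bilinExt g P Q := by
  rw [bilinExt_apply, bilinExt_apply]
  refine Finset.sum_congr rfl fun i hi => ?_
  dsimp only
  congr 1
  exact Finset.sum_congr rfl fun j hj => by dsimp only; rw [h i hi j hj]

@[simp] theorem linExt_single (f : Idx → Ann) (i : Idx) (c : ℚ≥0) :
    linExt f (.single i c) = c • f i := by
  simp [linExt]

@[simp] theorem bilinExt_single (f : Idx → Idx → Ann) (i j : Idx) (c d : ℚ≥0) :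
    bilinExt f (.single i c) (.single j d) = c • d • f i j := by
  simp [bilinExt]

theorem mem_support_linExt {f : Idx → Ann} {P : Ann} {k : Idx} (h : k ∈ (linExt f P).support) :
    ∃ i ∈ P.support, k ∈ (f i).support := by
  rw [linExt, Finsupp.linearCombination_apply] at h
  obtain ⟨i, hi, hk⟩ := Finsupp.mem_support_finsetSum k h
  exact ⟨i, hi, Finsupp.support_smul hk⟩

theorem mem_support_ofSet {B : Finset Idx} {k : Idx} (h : k ∈ (ofSet B).support) : k ∈ B := by
  obtain ⟨i, hi, hk⟩ := Finsupp.mem_support_finsetSum k h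
  have := Finsupp.support_single_subset hk
  rw [Finset.mem_singleton] at this
  exact this ▸ hi

theorem mem_support_foldA {P : Ann} {k : Idx} (h : k ∈ (foldA P).support) :
    ∃ i ∈ P.support, k = .fold i := by
  obtain ⟨i, hi, hk⟩ := mem_support_linExt h
  exact ⟨i, hi, Finset.mem_singleton.1 (Finsupp.support_single_subset hk)⟩

theorem mem_support_recA {τ : Ty} {P : Ann} {k : Idx} (h : k ∈ (recA τ P).support) :
    ∃ i ∈ P.support, k ∈ recIdx τ i := by
  obtain ⟨i, hi, hk⟩ := mem_support_linExt h
  exact ⟨i, hi, mem_support_ofSet hk⟩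

/-! ### Eventual values -/

/-- The sequence `f` is eventually equal to `R`. -/
def Ev (f : ℕ → Ann) (R : Ann) : Prop := ∀ᶠ n in atTop, f n = R

theorem Ev.const (R : Ann) : Ev (fun _ => R) R := Eventually.of_forall fun _ => rfl

theorem Ev.add {f g : ℕ → Ann} {R S : Ann} (hf : Ev f R) (hg : Ev g S) :
    Ev (fun n => f n + g n) (R + S) := by
  filter_upwards [hf, hg] with n h h'
  rw [h, h']

theorem Ev.map {f : ℕ → Ann} {R : Ann} (L : Ann →ₗ[ℚ≥0] Ann) (hf : Ev f R) :
    Ev (fun n => L (f n)) (L R) := by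
  filter_upwards [hf] with n h
  rw [h]

theorem Ev.map₂ {f g : ℕ → Ann} {R S : Ann} (L : Ann →ₗ[ℚ≥0] Ann →ₗ[ℚ≥0] Ann) (hf : Ev f R)
    (hg : Ev g S) : Ev (fun n => L (f n) (g n)) (L R S) := by
  filter_upwards [hf, hg] with n h h'
  rw [h, h']

theorem Ev.bilinExt {f : ℕ → Idx → Idx → Ann} {g : Idx → Idx → Ann} {P Q : Ann}
    (h : ∀ i ∈ P.support, ∀ j ∈ Q.support, Ev (fun n => f n i j) (g i j)) :
    Ev (fun n => bilinExt (f n) P Q) (bilinExt g P Q) := by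
  have : ∀ᶠ n in atTop, ∀ i ∈ P.support, ∀ j ∈ Q.support, f n i j = g i j := by
    rw [Filter.eventually_all_finset]
    intro i hi
    rw [Filter.eventually_all_finset]
    intro j hj
    exact h i hi j hj
  filter_upwards [this] with n hn
  exact bilinExt_congr hn

theorem Ev.of_succ {f : ℕ → Ann} {R : Ann} (h : Ev (fun n => f (n + 1)) R) : Ev f R := by
  obtain ⟨N, hN⟩ := eventually_atTop.1 h
  refine eventually_atTop.2 ⟨N + 1, fun n hn => ?_⟩
  obtain ⟨m, rfl⟩ : ∃ m, n = m + 1 := ⟨n - 1, by omega⟩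
  exact hN m (by omega)

theorem Ev.unique {f : ℕ → Ann} {R S : Ann} (h : Ev f R) (h' : Ev f S) : R = S := by
  obtain ⟨n, hn, hn'⟩ := (h.and h').exists
  exact hn.symm.trans hn'

open Classical in
/-- The stationary value of the operator `𝒩`. -/
noncomputable def two (τ σ : Ty) (i j : Idx) : Ann :=
  if h : ∃ R : Ann, ∀ᶠ n in atTop, (iter n).2 τ σ i j = R then h.choose else 0

theorem Ev.merge {τ : Ty} {i j : Idx} {R : Ann} (h : Ev (fun n => (iter n).1 τ i j) R) :
    AARA.merge τ i j = R := by
  have h' : ∃ R : Ann, ∀ᶠ n in atTop, (iter n).1 τ i j = R := ⟨R, h⟩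
  rw [AARA.merge, dif_pos h']
  exact Ev.unique h'.choose_spec h

theorem Ev.two {τ σ : Ty} {i j : Idx} {R : Ann} (h : Ev (fun n => (iter n).2 τ σ i j) R) :
    AARA.two τ σ i j = R := by
  have h' : ∃ R : Ann, ∀ᶠ n in atTop, (iter n).2 τ σ i j = R := ⟨R, h⟩
  rw [AARA.two, dif_pos h']
  exact Ev.unique h'.choose_spec h

/-- The iterates for `i ⋎_τ j` become stationary, and the limit satisfies its equation. -/
def MergeStable (τ : Ty) (i j : Idx) : Prop :=
  Ev (fun n => (iter n).1 τ i j) (merge τ i j) ∧ merge τ i j = mergeRhs merge two τ i j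

/-- The iterates for `𝒩{α[τ].σ}(i, j)` become stationary, and the limit satisfies its equation. -/
def TwoStable (τ σ : Ty) (i j : Idx) : Prop :=
  Ev (fun n => (iter n).2 τ σ i j) (two τ σ i j) ∧ two τ σ i j = twoRhs merge two τ σ i j

/-- By definition `iter (n + 1)` consists of the right-hand sides at `iter n`. Hence convergence of
the right-hand sides yields both the stationary value and its equation. -/
theorem MergeStable.of_rhs {τ : Ty} {i j : Idx}
    (h : Ev (fun n => mergeRhs (iter n).1 (iter n).2 τ i j) (mergeRhs merge two τ i j)) :
    MergeStable τ i j := by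
  have h' : Ev (fun n => (iter n).1 τ i j) (mergeRhs merge two τ i j) := Ev.of_succ h
  have e := h'.merge
  exact ⟨e ▸ h', e⟩

theorem TwoStable.of_rhs {τ σ : Ty} {i j : Idx}
    (h : Ev (fun n => twoRhs (iter n).1 (iter n).2 τ σ i j) (twoRhs merge two τ σ i j)) :
    TwoStable τ σ i j := by
  have h' : Ev (fun n => (iter n).2 τ σ i j) (twoRhs merge two τ σ i j) := Ev.of_succ h
  have e := h'.two
  exact ⟨e ▸ h', e⟩

theorem mergeStable_of_const {τ : Ty} {i j : Idx}
    (h : ∀ m m' N N', mergeRhs m N τ i j = mergeRhs m' N' τ i j) : MergeStable τ i j :=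
  .of_rhs (Eventually.of_forall fun _ => h _ _ _ _)

theorem twoStable_of_const {τ σ : Ty} {i j : Idx}
    (h : ∀ m m' N N', twoRhs m N τ σ i j = twoRhs m' N' τ σ i j) : TwoStable τ σ i j :=
  .of_rhs (Eventually.of_forall fun _ => h _ _ _ _)

/-- At a good type, a merge with `end` involves no recursive call. -/
theorem mergeStable_ending_left {r : Ty} (h : r.Good) (j : Idx) : MergeStable r .ending j := by
  apply mergeStable_of_const
  intros
  obtain ⟨-, rfl | ⟨t, rfl⟩⟩ := h <;> cases j <;> rfl

theorem mergeStable_ending_right {r : Ty} (h : r.Good) (i : Idx) : MergeStable r i .ending := by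
  apply mergeStable_of_const
  intros
  obtain ⟨-, rfl | ⟨t, rfl⟩⟩ := h <;> cases i <;> rfl

/-! ### Leaves -/

/-- `Leaf σ q k x`: in the index `k` for an instance of `σ`, the index `x` stands at an
occurrence of `var q`. -/
inductive Leaf : Ty → ℕ → Idx → Idx → Prop where
  | var {q : ℕ} {x : Idx} : Leaf (.var q) q x x
  | pairl {a b : Ty} {q : ℕ} {i j x : Idx} : Leaf a q i x → Leaf (.prod a b) q (.pair i j) x
  | pairr {a b : Ty} {q : ℕ} {i j x : Idx} : Leaf b q j x → Leaf (.prod a b) q (.pair i j) x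
  | inl {a b : Ty} {q : ℕ} {i x : Idx} : Leaf a q i x → Leaf (.sum a b) q (.inl i) x
  | inr {a b : Ty} {q : ℕ} {i x : Idx} : Leaf b q i x → Leaf (.sum a b) q (.inr i) x
  | here {s : Ty} {q : ℕ} {i x : Idx} : Leaf s (q + 1) i x → Leaf (.mu s) q (.fold i) x
  | deeper {s : Ty} {q : ℕ} {i y x : Idx} : Leaf s 0 i y → Leaf (.mu s) q y x →
      Leaf (.mu s) q (.fold i) x

theorem Leaf.sizeOf_le {σ : Ty} {q : ℕ} {k x : Idx} (h : Leaf σ q k x) :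
    sizeOf x ≤ sizeOf k := by
  induction h with
  | var => exact le_rfl
  | pairl _ ih => simp only [Idx.pair.sizeOf_spec]; omega
  | pairr _ ih => simp only [Idx.pair.sizeOf_spec]; omega
  | inl _ ih => simp only [Idx.inl.sizeOf_spec]; omega
  | inr _ ih => simp only [Idx.inr.sizeOf_spec]; omega
  | here _ ih => simp only [Idx.fold.sizeOf_spec]; omega
  | deeper _ _ ih₁ ih₂ => simp only [Idx.fold.sizeOf_spec]; omega

theorem leaf_constIdx {σ : Ty} {q : ℕ} {k x : Idx} (hx : Leaf σ q k x) {K : ℕ} {ρ : ℕ → Ty}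
    (h : ∀ n, (ρ n).Entry K) (hk : k ∈ constIdx (σ.sub ρ)) : x = .ending := by
  induction hx with
  | @var q x =>
    simp only [sub] at hk
    rcases h q with ⟨n, -, e⟩ | h
    · rw [e] at hk; simpa [constIdx] using hk
    · rw [constIdx_good h] at hk; simpa using hk
  | pairl _ ih => simp [sub, constIdx] at hk; exact ih hk.1
  | pairr _ ih => simp [sub, constIdx] at hk; exact ih hk.2
  | inl _ ih => simp [sub, constIdx] at hk; exact ih hk
  | inr _ ih => simp [sub, constIdx] at hk; exact ih hk
  | here _ => simp [sub, constIdx] at hk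
  | deeper _ _ => simp [sub, constIdx] at hk

/-- A substitution with one open variable, at position `p`. -/
def OpenAt (p : ℕ) (η : ℕ → Ty) : Prop := η p = .var 0 ∧ ∀ q, q ≠ p → (η q).Good

theorem OpenAt.entry {p : ℕ} {η : ℕ → Ty} (h : OpenAt p η) (n : ℕ) : (η n).Entry 1 := by
  by_cases hn : n = p
  · subst hn; rw [h.1]; exact .inl ⟨0, one_pos, rfl⟩
  · exact .inr (h.2 n hn)

theorem OpenAt.cons {p : ℕ} {η : ℕ → Ty} (h : OpenAt p η) {u : Ty} (hu : u.Good) :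
    OpenAt (p + 1) (cons u η) := by
  refine ⟨h.1, ?_⟩
  rintro (_ | q) hq
  · exact hu
  · exact h.2 q (by omega)

theorem openAt_lift {θ : ℕ → Ty} (h : ∀ n, (θ n).Good) : OpenAt 0 (lift θ) := by
  refine ⟨rfl, ?_⟩
  rintro (_ | q) hq
  · exact absurd rfl hq
  · change (θ q).shift.Good
    rw [(h q).shift_eq]; exact h q

theorem OpenAt.inst_good {p : ℕ} {η : ℕ → Ty} (h : OpenAt p η) {u : Ty} (hu : u.Good) (n : ℕ) :
    ((η n).inst 0 u).Good := by
  by_cases hn : n = p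
  · subst hn; rw [h.1]; exact hu
  · rw [(h.2 n hn).1.inst_eq u le_rfl]; exact h.2 n hn

/-- The index `i` is planted only at the open variable, and everything around it is constant, so it
shows `end` at its variables. Under `mu s` the bound variable is filled with `⊤_μ`; a leaf reached
through it would lie inside an `end`, which has no leaves at type `mu s`. -/
theorem leaf_recIdx (σ : Ty) {i : Idx} : ∀ {p q : ℕ} {η : ℕ → Ty} {k x : Idx}, OpenAt p η →
    k ∈ recIdx (σ.sub η) i → Leaf σ q k x → (q = p ∧ x = i) ∨ x = .ending := by
  induction σ with
  | var n =>
    intro p q η k x h hk hx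
    simp only [sub] at hk
    cases hx
    by_cases hn : n = p
    · subst hn; rw [h.1] at hk; simp [recIdx] at hk; exact .inl ⟨rfl, hk⟩
    · rw [recIdx_closed (h.2 n hn).1] at hk; simp at hk
  | top => intro p q η k x h hk hx; cases hx
  | unit => intro p q η k x h hk hx; cases hx
  | arrow a b _ _ => intro p q η k x h hk hx; cases hx
  | prod a b iha ihb =>
    intro p q η k x h hk hx
    cases hx with
    | pairl hx =>
      simp [sub, recIdx] at hk
      rcases hk with hk | hk
      · exact iha h hk.1 hx
      · exact .inr (leaf_constIdx hx h.entry hk.1)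
    | pairr hx =>
      simp [sub, recIdx] at hk
      rcases hk with hk | hk
      · exact .inr (leaf_constIdx hx h.entry hk.2)
      · exact ihb h hk.2 hx
  | sum a b iha ihb =>
    intro p q η k x h hk hx
    cases hx with
    | inl hx => simp [sub, recIdx] at hk; exact iha h hk hx
    | inr hx => simp [sub, recIdx] at hk; exact ihb h hk hx
  | mu s ih =>
    intro p q η k x h hk hx
    simp only [sub, recIdx] at hk
    rw [sub_lift_inst s good_top h.entry] at hk
    cases hx with
    | here hx =>
      simp at hk
      rcases ih (h.cons good_top) hk hx with ⟨e, e'⟩ | e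
      · exact .inl ⟨by omega, e'⟩
      · exact .inr e
    | deeper hy hx =>
      simp at hk
      rcases ih (h.cons good_top) hk hy with ⟨e, e'⟩ | e
      · omega
      · subst e; cases hx

/-! ### The iteration becomes stationary -/

theorem mergeStable_prod {a b : Ty} {i j : Idx}
    (h : ∀ i₁ i₂ j₁ j₂, i = .pair i₁ i₂ → j = .pair j₁ j₂ →
      MergeStable a i₁ j₁ ∧ MergeStable b i₂ j₂) : MergeStable (.prod a b) i j := by
  by_cases hi : ∃ i₁ i₂, i = .pair i₁ i₂
  · by_cases hj : ∃ j₁ j₂, j = .pair j₁ j₂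
    · obtain ⟨i₁, i₂, rfl⟩ := hi
      obtain ⟨j₁, j₂, rfl⟩ := hj
      obtain ⟨h₁, h₂⟩ := h _ _ _ _ rfl rfl
      exact .of_rhs (.map₂ pairA h₁.1 h₂.1)
    · apply mergeStable_of_const
      intros
      cases i <;> cases j <;> first | rfl | exact absurd ⟨_, _, rfl⟩ hj
  · apply mergeStable_of_const
    intros
    cases i <;> cases j <;> first | rfl | exact absurd ⟨_, _, rfl⟩ hi

theorem mergeStable_sum {a b : Ty} {i j : Idx}
    (hl : ∀ i₁ j₁, i = .inl i₁ → j = .inl j₁ → MergeStable a i₁ j₁)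
    (hr : ∀ i₁ j₁, i = .inr i₁ → j = .inr j₁ → MergeStable b i₁ j₁) :
    MergeStable (.sum a b) i j := by
  cases i with
  | inl i =>
    cases j with
    | inl j => exact .of_rhs ((hl _ _ rfl rfl).1.map inlA)
    | _ => exact mergeStable_of_const fun _ _ _ _ => rfl
  | inr i =>
    cases j with
    | inr j => exact .of_rhs ((hr _ _ rfl rfl).1.map inrA)
    | _ => exact mergeStable_of_const fun _ _ _ _ => rfl
  | _ => exact mergeStable_of_const fun _ _ _ _ => by cases j <;> rfl

theorem mergeStable_mu {t : Ty} {i j : Idx}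
    (h : ∀ i₁ j₁, i = .fold i₁ → j = .fold j₁ →
      MergeStable t.unfold i₁ j₁ ∧
      (∀ k ∈ recIdx t (.fold i₁), MergeStable t.unfold k j₁) ∧
      (∀ k ∈ recIdx t (.fold j₁), MergeStable t.unfold i₁ k) ∧
      TwoStable t t (.fold i₁) (.fold j₁)) : MergeStable (.mu t) i j := by
  by_cases hi : ∃ i₁, i = .fold i₁
  · by_cases hj : ∃ j₁, j = .fold j₁
    · obtain ⟨i₁, rfl⟩ := hi
      obtain ⟨j₁, rfl⟩ := hj
      obtain ⟨h₁, h₂, h₃, h₄⟩ := h _ _ rfl rfl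
      refine .of_rhs ((((h₁.1.map foldA).add (.map foldA (.bilinExt ?_))).add
        (.map foldA (.bilinExt ?_))).add (h₄.1.map foldA))
      · intro k hk l hl
        rw [Finset.mem_singleton.1 (Finsupp.support_single_subset hl)]
        exact (h₂ k (mem_support_ofSet hk)).1
      · intro k hk l hl
        rw [Finset.mem_singleton.1 (Finsupp.support_single_subset hk)]
        exact (h₃ l (mem_support_ofSet hl)).1
    · apply mergeStable_of_const
      intros
      cases i <;> cases j <;> first | rfl | exact absurd ⟨_, rfl⟩ hj
  · apply mergeStable_of_const
    intros
    cases i <;> cases j <;> first | rfl | exact absurd ⟨_, rfl⟩ hi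

theorem twoStable_prod {τ a b : Ty} {i j : Idx} (ha : TwoStable τ a i j)
    (hb : TwoStable τ b i j) : TwoStable τ (.prod a b) i j :=
  .of_rhs ((((ha.1.map₂ pairA (.const _)).add (.map₂ pairA (.const _) hb.1)).add
    (.const _)).add (.const _))

theorem twoStable_sum {τ a b : Ty} {i j : Idx} (ha : TwoStable τ a i j)
    (hb : TwoStable τ b i j) : TwoStable τ (.sum a b) i j :=
  .of_rhs ((ha.1.map inlA).add (hb.1.map inrA))

theorem twoStable_mu {τ s : Ty} {i j : Idx} (h₁ : TwoStable τ (s.inst 0 .top) i j)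
    (h₂ : ∀ k' ∈ recIdx (s.inst 0 .top) i, ∀ k ∈ recIdx (s.inst 1 (.mu τ)) (.fold k'),
      ∀ l ∈ recIdx (s.inst 0 .top) j, MergeStable (s.inst 1 (.mu τ)).unfold k l)
    (h₃ : ∀ k ∈ recIdx (s.inst 0 .top) i, ∀ l' ∈ recIdx (s.inst 0 .top) j,
      ∀ l ∈ recIdx (s.inst 1 (.mu τ)) (.fold l'), MergeStable (s.inst 1 (.mu τ)).unfold k l)
    (h₄ : ∀ k ∈ recIdx (s.inst 0 .top) i, ∀ l ∈ recIdx (s.inst 0 .top) j,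
      TwoStable (s.inst 1 (.mu τ)) (s.inst 1 (.mu τ)) (.fold k) (.fold l)) :
    TwoStable τ (.mu s) i j := by
  refine .of_rhs ((((h₁.1.map foldA).add (.map foldA (.bilinExt ?_))).add
    (.map foldA (.bilinExt ?_))).add (.map foldA (.bilinExt ?_)))
  · intro k hk l hl
    obtain ⟨k₁, hk₁, hk⟩ := mem_support_recA hk
    obtain ⟨k', hk', rfl⟩ := mem_support_foldA hk₁
    exact (h₂ k' (mem_support_ofSet hk') k hk l (mem_support_ofSet hl)).1
  · intro k hk l hl
    obtain ⟨l₁, hl₁, hl⟩ := mem_support_recA hl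
    obtain ⟨l', hl', rfl⟩ := mem_support_foldA hl₁
    exact (h₃ k (mem_support_ofSet hk) l' (mem_support_ofSet hl') l hl).1
  · intro k hk l hl
    obtain ⟨k', hk', rfl⟩ := mem_support_foldA hk
    obtain ⟨l', hl', rfl⟩ := mem_support_foldA hl
    exact (h₄ k' (mem_support_ofSet hk') l' (mem_support_ofSet hl')).1

/-- Without occurrences of `α` all sets `ℳ` are empty, so the merges in the case `mu s` range over
nothing. -/
theorem twoStable_closed {t : Ty} (h : t.Closed 0) (τ : Ty) (i j : Idx) :
    TwoStable τ t i j := by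
  induction hn : t.size using Nat.strong_induction_on generalizing t with
  | _ n ih =>
    subst hn
    cases t with
    | var n => exact absurd h (Nat.not_lt_zero n)
    | top => exact twoStable_of_const fun _ _ _ _ => rfl
    | unit => exact twoStable_of_const fun _ _ _ _ => rfl
    | arrow a b _ _ => exact twoStable_of_const fun _ _ _ _ => rfl
    | prod a b =>
      exact twoStable_prod (ih a.size (by simp only [size]; omega) h.1 rfl)
        (ih b.size (by simp only [size]; omega) h.2 rfl)
    | sum a b =>
      exact twoStable_sum (ih a.size (by simp only [size]; omega) h.1 rfl)
        (ih b.size (by simp only [size]; omega) h.2 rfl)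
    | mu s =>
      have hs : (s.inst 0 top).Closed 0 := Closed.inst good_top.1 h le_rfl
      refine twoStable_mu (ih _ (by simp only [size, size_inst_top]; omega) hs rfl) ?_ ?_ ?_ <;>
        simp [recIdx_closed hs]

/-- If the leaves of two indices can be merged, so can the indices; and the operator `𝒩` is
always stationary. -/
theorem stable_sub (σ : Ty) :
    (∀ {θ : ℕ → Ty} {a b : Idx}, (∀ n, (θ n).Good) →
      (∀ q x y, Leaf σ q a x → Leaf σ q b y → MergeStable (θ q) x y) →
      MergeStable (σ.sub θ) a b) ∧
    (∀ {τ : Ty} {p : ℕ} {η : ℕ → Ty} (i j : Idx), τ.Closed 1 → OpenAt p η →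
      TwoStable τ (σ.sub η) i j) := by
  induction σ with
  | var n =>
    refine ⟨fun _ h => h n _ _ .var .var, ?_⟩
    intro τ p η i j _ h
    rcases h.entry n with ⟨m, -, e⟩ | e
    · simp only [sub, e]
      exact twoStable_of_const fun _ _ _ _ => rfl
    · exact twoStable_closed e.1 τ i j
  | top =>
    refine ⟨@fun _ a b _ _ => mergeStable_of_const fun _ _ _ _ => ?_,
      fun _ _ _ _ => twoStable_of_const fun _ _ _ _ => rfl⟩
    cases a <;> cases b <;> rfl
  | unit =>
    refine ⟨@fun _ a b _ _ => mergeStable_of_const fun _ _ _ _ => ?_,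
      fun _ _ _ _ => twoStable_of_const fun _ _ _ _ => rfl⟩
    cases a <;> cases b <;> rfl
  | arrow =>
    refine ⟨@fun _ a b _ _ => mergeStable_of_const fun _ _ _ _ => ?_,
      fun _ _ _ _ => twoStable_of_const fun _ _ _ _ => rfl⟩
    cases a <;> cases b <;> rfl
  | prod a b iha ihb =>
    refine ⟨fun hθ h => mergeStable_prod ?_,
      fun i j hτ h => twoStable_prod (iha.2 i j hτ h) (ihb.2 i j hτ h)⟩
    rintro i₁ i₂ j₁ j₂ rfl rfl
    exact ⟨iha.1 hθ fun q x y hx hy => h q x y hx.pairl hy.pairl,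
      ihb.1 hθ fun q x y hx hy => h q x y hx.pairr hy.pairr⟩
  | sum a b iha ihb =>
    refine ⟨fun hθ h => mergeStable_sum ?_ ?_,
      fun i j hτ h => twoStable_sum (iha.2 i j hτ h) (ihb.2 i j hτ h)⟩
    · rintro i j rfl rfl
      exact iha.1 hθ fun q x y hx hy => h q x y hx.inl hy.inl
    · rintro i j rfl rfl
      exact ihb.1 hθ fun q x y hx hy => h q x y hx.inr hy.inr
  | mu s ih =>
    constructor
    · intro θ a b hθ h
      have hθ' : ∀ n, (θ n).Entry 0 := fun n => .inr (hθ n)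
      have hc : (s.sub (lift θ)).Closed 1 := closed_sub s (entry_lift hθ')
      have hu : (s.sub (lift θ)).unfold = s.sub (cons ((mu s).sub θ) θ) :=
        sub_lift_inst s (good_mu hc) hθ'
      have hgood : ∀ n, (cons ((mu s).sub θ) θ n).Good := by
        rintro (_ | n)
        · exact good_mu hc
        · exact hθ n
      induction hn : sizeOf a + sizeOf b using Nat.strong_induction_on generalizing a b with
      | _ n ihn =>
      subst hn
      apply mergeStable_mu
      rintro i j rfl rfl
      rw [hu]
      simp only [Idx.fold.sizeOf_spec] at ihn
      refine ⟨ih.1 hgood ?_, fun k hk => ih.1 hgood ?_, fun k hk => ih.1 hgood ?_,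
        ih.2 _ _ hc (openAt_lift hθ)⟩
      -- A leaf at `var 0` is a smaller index for the recursive type itself, and its leaves are
      -- leaves of the whole index by `Leaf.deeper`.
      · rintro (_ | q) x y hx hy
        · have := hx.sizeOf_le
          have := hy.sizeOf_le
          exact ihn _ (by omega) (fun q x' y' hx' hy' =>
            h q x' y' (hx.deeper hx') (hy.deeper hy')) rfl
        · exact h q x y hx.here hy.here
      · intro q x y hx hy
        rcases leaf_recIdx s (openAt_lift hθ) hk hx with ⟨rfl, rfl⟩ | rfl
        -- Here `fold i` returns in full, but `y` is no larger than `j`, hence smaller than `fold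
        -- j`: the total size still drops.
        · have := hy.sizeOf_le
          exact ihn _ (by simp only [Idx.fold.sizeOf_spec]; omega) (fun q x' y' hx' hy' =>
            h q x' y' hx' (hy.deeper hy')) rfl
        · exact mergeStable_ending_left (hgood q) y
      · intro q x y hx hy
        rcases leaf_recIdx s (openAt_lift hθ) hk hy with ⟨rfl, rfl⟩ | rfl
        · have := hx.sizeOf_le
          exact ihn _ (by simp only [Idx.fold.sizeOf_spec]; omega) (fun q x' y' hx' hy' =>
            h q x' y' (hx.deeper hx') hy') rfl
        · exact mergeStable_ending_right (hgood q) x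
    · intro τ p η i j hτ h
      have hg := h.inst_good (good_mu hτ)
      have hg' : ∀ n, ((η n).inst 0 (mu τ)).Entry 0 := fun n => .inr (hg n)
      have e₀ : (s.sub (lift η)).inst 0 top = s.sub (cons top η) :=
        sub_lift_inst s good_top h.entry
      have e₁ : (s.sub (lift η)).inst 1 (mu τ) = s.sub (lift fun n => (η n).inst 0 (mu τ)) := by
        have := sub_inst (mu s) (good_mu hτ) 0 h.entry
        simpa only [sub, inst, mu.injEq] using this
      have hc : (s.sub (lift fun n => (η n).inst 0 (mu τ))).Closed 1 :=
        closed_sub s (entry_lift hg')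
      have hu : (s.sub (lift fun n => (η n).inst 0 (mu τ))).unfold =
          s.sub (cons (mu (s.sub (lift fun n => (η n).inst 0 (mu τ))))
            fun n => (η n).inst 0 (mu τ)) :=
        sub_lift_inst s (good_mu hc) hg'
      have hgood : ∀ n, (cons (mu (s.sub (lift fun n => (η n).inst 0 (mu τ))))
          (fun n => (η n).inst 0 (mu τ)) n).Good := by
        rintro (_ | n)
        · exact good_mu hc
        · exact hg n
      apply twoStable_mu
      · rw [e₀]; exact ih.2 i j hτ (h.cons good_top)
      · rw [e₀, e₁, hu]
        intro k' hk' k hk l hl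
        refine ih.1 hgood fun q x y hx hy => ?_
        -- A leaf of `k` other than `end` is at `var 0`, one of `l` at `var (p + 1)`. They never
        -- share a variable, so no size measure is needed.
        rcases leaf_recIdx s (openAt_lift hg) hk hx with ⟨e, -⟩ | rfl
        · rcases leaf_recIdx s (h.cons good_top) hl hy with ⟨e', -⟩ | rfl
          · omega
          · exact mergeStable_ending_right (hgood q) x
        · exact mergeStable_ending_left (hgood q) y
      · rw [e₀, e₁, hu]
        intro k hk l' hl' l hl
        refine ih.1 hgood fun q x y hx hy => ?_
        rcases leaf_recIdx s (openAt_lift hg) hl hy with ⟨e, -⟩ | rfl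
        · rcases leaf_recIdx s (h.cons good_top) hk hx with ⟨e', -⟩ | rfl
          · omega
          · exact mergeStable_ending_left (hgood q) y
        · exact mergeStable_ending_right (hgood q) x
      · rw [e₁]
        intro k hk l hl
        exact ih.2 _ _ hc (openAt_lift hg)

theorem mergeStable {τ : Ty} (h : τ.Closed 0) (i j : Idx) : MergeStable τ i j := by
  rw [← sub_tops h]
  refine (stable_sub τ).1 (fun _ => good_top) fun q x y _ _ => ?_
  apply mergeStable_of_const
  intros
  cases x <;> cases y <;> rfl

theorem openAt_var_tops : OpenAt 0 (cons (.var 0) tops) := by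
  refine ⟨rfl, ?_⟩
  rintro (_ | q) hq
  · exact absurd rfl hq
  · exact good_top

theorem twoStable {τ σ : Ty} (hτ : τ.Closed 1) (hσ : σ.Closed 1) (i j : Idx) :
    TwoStable τ σ i j := by
  rw [← sub_var_tops hσ]
  exact (stable_sub σ).2 i j hτ openAt_var_tops

/-! ### Values and indices for types with `⊤_μ` -/

/-- `HasVal` for types with `⊤_μ`, which stands for an unspecified recursive type. -/
inductive HasValT : Ty → Val → Prop where
  | tt : HasValT .unit .tt
  | pair {a b : Ty} {v w : Val} : HasValT a v → HasValT b w → HasValT (.prod a b) (.pair v w)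
  | inl {a b : Ty} {v : Val} : HasValT a v → HasValT (.sum a b) (.inl v)
  | inr {a b : Ty} {v : Val} : HasValT b v → HasValT (.sum a b) (.inr v)
  | func {a b : Ty} {Θ Θcf : Set (Ann × Ann)} {e : Exp} : HasValT (.arrow a b Θ Θcf) (.func e)
  | fold {t : Ty} {v : Val} : HasValT t.unfold v → HasValT (.mu t) (.fold v)
  | top {v : Val} : HasValT .top (.fold v)

/-- `HasIdx` for types with `⊤_μ`. -/
inductive HasIdxT : Ty → Idx → Prop where
  | tt : HasIdxT .unit .tt
  | pair {a b : Ty} {i j : Idx} : HasIdxT a i → HasIdxT b j → HasIdxT (.prod a b) (.pair i j)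
  | inl {a b : Ty} {i : Idx} : HasIdxT a i → HasIdxT (.sum a b) (.inl i)
  | inr {a b : Ty} {i : Idx} : HasIdxT b i → HasIdxT (.sum a b) (.inr i)
  | lam {a b : Ty} {Θ Θcf : Set (Ann × Ann)} : HasIdxT (.arrow a b Θ Θcf) .lam
  | fold {t : Ty} {i : Idx} : HasIdxT t.unfold i → HasIdxT (.mu t) (.fold i)
  | ending {t : Ty} : HasIdxT (.mu t) .ending
  | top : HasIdxT .top .ending

/-- `phi` for types with `⊤_μ`. -/
def psi : Val → Ty → Idx → ℚ≥0
  | .tt, .unit, .tt => 1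
  | .pair v w, .prod a b, .pair i j => psi v a i * psi w b j
  | .inl v, .sum a _, .inl i => psi v a i
  | .inr w, .sum _ b, .inr j => psi w b j
  | .func _, .arrow _ _ _ _, .lam => 1
  | .fold v, .mu t, .fold i => psi v t.unfold i + ∑ k ∈ recIdx t (.fold i), psi v t.unfold k
  | .fold _, .mu _, .ending => 1
  | .fold _, .top, .ending => 1
  | _, _, _ => 0

/-! ### Typing and evaluation under a change of substitution -/

theorem Ty.Good.cons {u : Ty} (hu : u.Good) {θ : ℕ → Ty} (hθ : ∀ n, (θ n).Good) (n : ℕ) :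
    (cons u θ n).Good := by
  cases n with
  | zero => exact hu
  | succ n => exact hθ n

theorem Ty.good_mu_sub {θ : ℕ → Ty} (hθ : ∀ n, (θ n).Good) (s : Ty) : ((mu s).sub θ).Good :=
  good_mu (closed_sub s (entry_lift fun n => .inr (hθ n)))

theorem Ty.unfold_sub {θ : ℕ → Ty} (hθ : ∀ n, (θ n).Good) (s : Ty) :
    (s.sub (lift θ)).unfold = s.sub (Ty.cons ((mu s).sub θ) θ) :=
  sub_lift_inst s (good_mu_sub hθ s) (K := 0) fun n => .inr (hθ n)

/-- The induction is on the index, not on the type. Below `mu s` the substitutions gain the entries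
`(mu s).sub η` and `(mu s).sub η'`, and the hypothesis for these entries is the induction hypothesis
at smaller indices. -/
theorem HasIdxT.transfer {σ : Ty} {η η' : ℕ → Ty} {k : Idx} (hη : ∀ n, (η n).Good)
    (hη' : ∀ n, (η' n).Good)
    (h : ∀ q x, sizeOf x ≤ sizeOf k → HasIdxT (η q) x → HasIdxT (η' q) x)
    (hk : HasIdxT (σ.sub η) k) : HasIdxT (σ.sub η') k := by
  induction hn : sizeOf k using Nat.strong_induction_on generalizing σ η η' k with
  | _ n ih =>
  subst hn
  cases σ with
  | var q => exact h q k le_rfl hk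
  | top => exact hk
  | unit => exact hk
  | arrow a b _ _ => cases hk; exact .lam
  | prod a b =>
    cases hk with
    | @pair _ _ i j hi hj =>
      simp only [Idx.pair.sizeOf_spec] at ih h
      exact .pair (ih _ (by omega) hη hη' (fun q x hx => h q x (by omega)) hi rfl)
        (ih _ (by omega) hη hη' (fun q x hx => h q x (by omega)) hj rfl)
  | sum a b =>
    cases hk with
    | inl hi =>
      simp only [Idx.inl.sizeOf_spec] at ih h
      exact .inl (ih _ (by omega) hη hη' (fun q x hx => h q x (by omega)) hi rfl)
    | inr hi =>
      simp only [Idx.inr.sizeOf_spec] at ih h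
      exact .inr (ih _ (by omega) hη hη' (fun q x hx => h q x (by omega)) hi rfl)
  | mu s =>
    cases hk with
    | ending => exact .ending
    | fold hi =>
      simp only [Idx.fold.sizeOf_spec] at ih h
      refine .fold ?_
      rw [unfold_sub hη] at hi
      rw [unfold_sub hη']
      refine ih _ (by omega) (.cons (good_mu_sub hη s) hη) (.cons (good_mu_sub hη' s) hη')
        ?_ hi rfl
      rintro (_ | q) x hx hx'
      · exact ih _ (by omega) hη hη' (fun q y hy => h q y (by omega)) hx' rfl
      · exact h q x (by omega) hx'

theorem HasValT.transfer {σ : Ty} {η η' : ℕ → Ty} {v : Val} (hη : ∀ n, (η n).Good)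
    (hη' : ∀ n, (η' n).Good)
    (h : ∀ q w, sizeOf w ≤ sizeOf v → HasValT (η q) w → HasValT (η' q) w)
    (hv : HasValT (σ.sub η) v) : HasValT (σ.sub η') v := by
  induction hn : sizeOf v using Nat.strong_induction_on generalizing σ η η' v with
  | _ n ih =>
  subst hn
  cases σ with
  | var q => exact h q v le_rfl hv
  | top => exact hv
  | unit => exact hv
  | arrow a b _ _ => cases hv; exact .func
  | prod a b =>
    cases hv with
    | pair hi hj =>
      simp only [Val.pair.sizeOf_spec] at ih h
      exact .pair (ih _ (by omega) hη hη' (fun q x hx => h q x (by omega)) hi rfl)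
        (ih _ (by omega) hη hη' (fun q x hx => h q x (by omega)) hj rfl)
  | sum a b =>
    cases hv with
    | inl hi =>
      simp only [Val.inl.sizeOf_spec] at ih h
      exact .inl (ih _ (by omega) hη hη' (fun q x hx => h q x (by omega)) hi rfl)
    | inr hi =>
      simp only [Val.inr.sizeOf_spec] at ih h
      exact .inr (ih _ (by omega) hη hη' (fun q x hx => h q x (by omega)) hi rfl)
  | mu s =>
    cases hv with
    | fold hi =>
      simp only [Val.fold.sizeOf_spec] at ih h
      refine .fold ?_
      rw [unfold_sub hη] at hi
      rw [unfold_sub hη']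
      refine ih _ (by omega) (.cons (good_mu_sub hη s) hη) (.cons (good_mu_sub hη' s) hη')
        ?_ hi rfl
      rintro (_ | q) x hx hx'
      · exact ih _ (by omega) hη hη' (fun q y hy => h q y (by omega)) hx' rfl
      · exact h q x (by omega) hx'

/-- The only index for `⊤_μ` is `end`, which every recursive type has. -/
theorem HasIdxT.inst_top {s τ : Ty} (hs : s.Closed 2) (hτ : τ.Closed 1) {k : Idx}
    (h : HasIdxT ((s.inst 0 .top).inst 0 (.mu τ)) k) :
    HasIdxT (s.inst 1 (.mu τ)).unfold k := by
  have h₁ : (s.inst 1 (mu τ)).Closed 1 := Closed.inst (good_mu hτ).1 hs le_rfl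
  rw [inst_zero_inst_zero hs good_top (good_mu hτ)] at h
  rw [unfold, inst_one_inst_zero hs (good_mu h₁) (good_mu hτ)]
  refine h.transfer (.cons good_top (.cons (good_mu hτ) fun _ => good_top))
    (.cons (good_mu h₁) (.cons (good_mu hτ) fun _ => good_top)) ?_
  rintro (_ | q) x _ hx
  · cases hx; exact .ending
  · exact hx

/-- Values go the opposite way to indices: every `fold` is a value of `⊤_μ`. -/
theorem HasValT.inst_top {s τ : Ty} (hs : s.Closed 2) (hτ : τ.Closed 1) {v : Val}
    (h : HasValT (s.inst 1 (.mu τ)).unfold v) :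
    HasValT ((s.inst 0 .top).inst 0 (.mu τ)) v := by
  have h₁ : (s.inst 1 (mu τ)).Closed 1 := Closed.inst (good_mu hτ).1 hs le_rfl
  rw [inst_zero_inst_zero hs good_top (good_mu hτ)]
  rw [unfold, inst_one_inst_zero hs (good_mu h₁) (good_mu hτ)] at h
  refine h.transfer (.cons (good_mu h₁) (.cons (good_mu hτ) fun _ => good_top))
    (.cons good_top (.cons (good_mu hτ) fun _ => good_top)) ?_
  rintro (_ | q) x _ hx
  · cases hx; exact .top
  · exact hx

theorem hasIdxT_constIdx {σ : Ty} (τ : Ty) (hσ : σ.Closed 1) {k : Idx} (hk : k ∈ constIdx σ) :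
    HasIdxT (σ.inst 0 (.mu τ)) k := by
  induction σ generalizing k with
  | var n =>
    obtain rfl : n = 0 := by simpa [Closed] using hσ
    simp [constIdx] at hk; subst hk; exact .ending
  | top => simp [constIdx] at hk; subst hk; exact .top
  | unit => simp [constIdx] at hk; subst hk; exact .tt
  | arrow a b _ _ => simp [constIdx] at hk; subst hk; exact .lam
  | prod a b iha ihb =>
    simp [constIdx] at hk
    obtain ⟨i, j, ⟨hi, hj⟩, rfl⟩ := hk
    exact .pair (iha hσ.1 hi) (ihb hσ.2 hj)
  | sum a b iha ihb =>
    simp [constIdx] at hk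
    rcases hk with ⟨i, hi, rfl⟩ | ⟨i, hi, rfl⟩
    · exact .inl (iha hσ.1 hi)
    · exact .inr (ihb hσ.2 hi)
  | mu s => simp [constIdx] at hk; subst hk; exact .ending

theorem hasIdxT_recIdx {σ τ : Ty} (hσ : σ.Closed 1) (hτ : τ.Closed 1) {i : Idx}
    (hi : HasIdxT (.mu τ) i) {k : Idx} (hk : k ∈ recIdx σ i) : HasIdxT (σ.inst 0 (.mu τ)) k := by
  induction hn : σ.size using Nat.strong_induction_on generalizing σ k with
  | _ n ih =>
  subst hn
  cases σ with
  | var n =>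
    obtain rfl : n = 0 := by simpa [Closed] using hσ
    simp [recIdx] at hk; subst hk; exact hi
  | top => simp [recIdx] at hk
  | unit => simp [recIdx] at hk
  | arrow a b _ _ => simp [recIdx] at hk
  | prod a b =>
    simp only [size] at ih
    simp [recIdx] at hk
    rcases hk with ⟨i, j, ⟨hi, hj⟩, rfl⟩ | ⟨i, j, ⟨hi, hj⟩, rfl⟩
    · exact .pair (ih _ (by omega) hσ.1 hi rfl) (hasIdxT_constIdx τ hσ.2 hj)
    · exact .pair (hasIdxT_constIdx τ hσ.1 hi) (ih _ (by omega) hσ.2 hj rfl)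
  | sum a b =>
    simp only [size] at ih
    simp [recIdx] at hk
    rcases hk with ⟨i, hi, rfl⟩ | ⟨i, hi, rfl⟩
    · exact .inl (ih _ (by omega) hσ.1 hi rfl)
    · exact .inr (ih _ (by omega) hσ.2 hi rfl)
  | mu s =>
    simp only [size] at ih
    simp [recIdx] at hk
    obtain ⟨k, hk, rfl⟩ := hk
    refine .fold (HasIdxT.inst_top hσ hτ ?_)
    exact ih _ (by rw [size_inst_top]; omega) (Closed.inst good_top.1 hσ (Nat.zero_le _)) hk rfl

theorem psi_transfer {σ : Ty} {η η' : ℕ → Ty} {v : Val} {k : Idx} (hη : ∀ n, (η n).Good)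
    (hη' : ∀ n, (η' n).Good)
    (h : ∀ q w x, sizeOf w ≤ sizeOf v → HasIdxT (η q) x → psi w (η q) x = psi w (η' q) x)
    (hk : HasIdxT (σ.sub η) k) : psi v (σ.sub η) k = psi v (σ.sub η') k := by
  induction hn : sizeOf v using Nat.strong_induction_on generalizing σ η η' v k with
  | _ n ih =>
  subst hn
  cases σ with
  | var q => exact h q v k le_rfl hk
  | top => rfl
  | unit => rfl
  | arrow a b _ _ => cases v <;> cases k <;> rfl
  | prod a b =>
    cases hk with
    | pair hi hj =>
      cases v with
      | pair v w =>
        simp only [Val.pair.sizeOf_spec] at ih h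
        simp only [sub, psi]
        rw [ih _ (by omega) hη hη' (fun q w x hx => h q w x (by omega)) hi rfl,
          ih _ (by omega) hη hη' (fun q w x hx => h q w x (by omega)) hj rfl]
      | _ => rfl
  | sum a b =>
    cases hk with
    | inl hi =>
      cases v with
      | inl v =>
        simp only [Val.inl.sizeOf_spec] at ih h
        simp only [sub, psi]
        exact ih _ (by omega) hη hη' (fun q w x hx => h q w x (by omega)) hi rfl
      | _ => rfl
    | inr hi =>
      cases v with
      | inr v =>
        simp only [Val.inr.sizeOf_spec] at ih h
        simp only [sub, psi]
        exact ih _ (by omega) hη hη' (fun q w x hx => h q w x (by omega)) hi rfl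
      | _ => rfl
  | mu s =>
    have hk₀ := hk
    cases hk with
    | ending => cases v <;> rfl
    | @fold _ i hi =>
      cases v with
      | fold v =>
        simp only [Val.fold.sizeOf_spec] at ih h
        have key : ∀ k, HasIdxT (s.sub (lift η)).unfold k →
            psi v (s.sub (lift η)).unfold k = psi v (s.sub (lift η')).unfold k := by
          intro k hk
          rw [unfold_sub hη] at hk ⊢
          rw [unfold_sub hη']
          refine ih _ (by omega) (.cons (good_mu_sub hη s) hη) (.cons (good_mu_sub hη' s) hη')
            ?_ hk rfl
          rintro (_ | q) w x hx hx'
          · exact ih _ (by omega) hη hη' (fun q w x hx => h q w x (by omega)) hx' rfl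
          · exact h q w x (by omega) hx'
        have hr : recIdx (s.sub (lift η)) (.fold i) = recIdx (s.sub (lift η')) (.fold i) := by
          refine recIdx_sub_congr s _ (K := 1) (entry_lift fun n => .inr (hη n))
            (entry_lift fun n => .inr (hη' n)) ?_
          rintro (_ | n)
          · exact .inl ⟨0, rfl, rfl⟩
          · exact Alike.shift (.inr ⟨hη n, hη' n⟩)
        have hc := closed_sub s (entry_lift (k := 0) fun n => .inr (hη n))
        simp only [sub, psi]
        rw [key i hi, ← hr]
        congr 1
        exact Finset.sum_congr rfl fun k hk => key k (hasIdxT_recIdx hc hc hk₀ hk)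
      | _ => rfl

/-- Where the two types differ, the index is `end`, and it evaluates alike at `⊤_μ` and at a
recursive type. -/
theorem psi_inst_top {s τ : Ty} (hs : s.Closed 2) (hτ : τ.Closed 1) (v : Val) {k : Idx}
    (h : HasIdxT ((s.inst 0 .top).inst 0 (.mu τ)) k) :
    psi v (s.inst 1 (.mu τ)).unfold k = psi v ((s.inst 0 .top).inst 0 (.mu τ)) k := by
  have h₁ : (s.inst 1 (mu τ)).Closed 1 := Closed.inst (good_mu hτ).1 hs le_rfl
  rw [inst_zero_inst_zero hs good_top (good_mu hτ)] at h ⊢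
  rw [unfold, inst_one_inst_zero hs (good_mu h₁) (good_mu hτ)]
  refine (psi_transfer (.cons good_top (.cons (good_mu hτ) fun _ => good_top))
    (.cons (good_mu h₁) (.cons (good_mu hτ) fun _ => good_top)) ?_ h).symm
  rintro (_ | q) w x _ hx
  · cases hx; cases w <;> rfl
  · rfl

/-! ### Sharing is typed -/

/-- `annotations` for types with `⊤_μ`. -/
noncomputable def annT (τ : Ty) : Submodule ℚ≥0 Ann :=
  Finsupp.supported ℚ≥0 ℚ≥0 {i | HasIdxT τ i}

theorem mem_annT {τ : Ty} {P : Ann} : P ∈ annT τ ↔ ∀ i ∈ P.support, HasIdxT τ i := by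
  simp [annT, Finsupp.mem_supported, Set.subset_def]

theorem single_mem_annT {τ : Ty} {i : Idx} (h : HasIdxT τ i) : (.single i 1 : Ann) ∈ annT τ :=
  Finsupp.single_mem_supported _ _ h

theorem ofSet_mem_annT {τ : Ty} {B : Finset Idx} (h : ∀ i ∈ B, HasIdxT τ i) :
    ofSet B ∈ annT τ :=
  Submodule.sum_mem _ fun i hi => single_mem_annT (h i hi)

theorem linExt_mem {S : Submodule ℚ≥0 Ann} {f : Idx → Ann} {τ : Ty} {P : Ann} (hP : P ∈ annT τ)
    (h : ∀ i, HasIdxT τ i → f i ∈ S) : linExt f P ∈ S := by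
  rw [linExt, Finsupp.linearCombination_apply]
  exact Submodule.sum_mem _ fun i hi => S.smul_mem _ (h i (mem_annT.1 hP i hi))

theorem bilinExt_mem {S : Submodule ℚ≥0 Ann} {f : Idx → Idx → Ann} {τ ρ : Ty} {P Q : Ann}
    (hP : P ∈ annT τ) (hQ : Q ∈ annT ρ) (h : ∀ i j, HasIdxT τ i → HasIdxT ρ j → f i j ∈ S) :
    bilinExt f P Q ∈ S := by
  rw [bilinExt_apply]
  exact Submodule.sum_mem _ fun i hi => S.smul_mem _ <| Submodule.sum_mem _ fun j hj =>
    S.smul_mem _ (h i j (mem_annT.1 hP i hi) (mem_annT.1 hQ j hj))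

theorem inlA_mem {a b : Ty} {P : Ann} (h : P ∈ annT a) : inlA P ∈ annT (.sum a b) :=
  linExt_mem h fun _ hi => single_mem_annT hi.inl

theorem inrA_mem {a b : Ty} {P : Ann} (h : P ∈ annT b) : inrA P ∈ annT (.sum a b) :=
  linExt_mem h fun _ hi => single_mem_annT hi.inr

theorem foldA_mem {t : Ty} {P : Ann} (h : P ∈ annT t.unfold) : foldA P ∈ annT (.mu t) :=
  linExt_mem h fun _ hi => single_mem_annT hi.fold

theorem pairA_mem {a b : Ty} {P Q : Ann} (h : P ∈ annT a) (h' : Q ∈ annT b) :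
    pairA P Q ∈ annT (.prod a b) :=
  bilinExt_mem h h' fun _ _ hi hj => single_mem_annT (hi.pair hj)

theorem ofSet_recIdx_mem {σ τ : Ty} (hσ : σ.Closed 1) (hτ : τ.Closed 1) {i : Idx}
    (hi : HasIdxT (.mu τ) i) : ofSet (recIdx σ i) ∈ annT (σ.inst 0 (.mu τ)) :=
  ofSet_mem_annT fun _ hk => hasIdxT_recIdx hσ hτ hi hk

theorem recA_mem {σ τ : Ty} (hσ : σ.Closed 1) (hτ : τ.Closed 1) {P : Ann}
    (hP : P ∈ annT (.mu τ)) : recA σ P ∈ annT (σ.inst 0 (.mu τ)) :=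
  linExt_mem hP fun _ hi => ofSet_recIdx_mem hσ hτ hi

theorem ofSet_constIdx_mem {σ : Ty} (τ : Ty) (hσ : σ.Closed 1) :
    ofSet (constIdx σ) ∈ annT (σ.inst 0 (.mu τ)) :=
  ofSet_mem_annT fun _ hk => hasIdxT_constIdx τ hσ hk

theorem inst_top_mem {s τ : Ty} (hs : s.Closed 2) (hτ : τ.Closed 1) {P : Ann}
    (h : P ∈ annT ((s.inst 0 .top).inst 0 (.mu τ))) : P ∈ annT (s.inst 1 (.mu τ)).unfold :=
  mem_annT.2 fun i hi => (mem_annT.1 h i hi).inst_top hs hτ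

/-- Typing is an invariant of the iteration, so it passes to the stationary values without any
further induction on types or indices. -/
theorem iter_mem (n : ℕ) :
    (∀ {τ : Ty} {i j : Idx}, τ.Closed 0 → HasIdxT τ i → HasIdxT τ j →
      (iter n).1 τ i j ∈ annT τ) ∧
    (∀ {τ σ : Ty} {i j : Idx}, τ.Closed 1 → σ.Closed 1 → HasIdxT (.mu τ) i → HasIdxT (.mu τ) j →
      (iter n).2 τ σ i j ∈ annT (σ.inst 0 (.mu τ))) := by
  induction n with
  | zero => exact ⟨fun _ _ _ => Submodule.zero_mem _, fun _ _ _ _ => Submodule.zero_mem _⟩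
  | succ n ih =>
    obtain ⟨ihm, ihN⟩ := ih
    constructor
    · intro τ i j hτ hi hj
      cases hi with
      | tt => cases hj; exact single_mem_annT .tt
      | lam => cases hj; exact single_mem_annT .lam
      | top => cases hj; exact single_mem_annT .top
      | pair hi₁ hi₂ =>
        cases hj with
        | pair hj₁ hj₂ => exact pairA_mem (ihm hτ.1 hi₁ hj₁) (ihm hτ.2 hi₂ hj₂)
      | inl hi =>
        cases hj with
        | inl hj => exact inlA_mem (ihm hτ.1 hi hj)
        | inr hj => exact Submodule.zero_mem _
      | inr hi =>
        cases hj with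
        | inr hj => exact inrA_mem (ihm hτ.2 hi hj)
        | inl hj => exact Submodule.zero_mem _
      | ending =>
        cases hj with
        | ending => exact single_mem_annT .ending
        | fold hj => exact single_mem_annT hj.fold
      | @fold t i hi =>
        cases hj with
        | ending => exact single_mem_annT hi.fold
        | @fold _ j hj =>
          have hu : t.unfold.Closed 0 := Closed.inst (u := mu t) hτ hτ le_rfl
          have hb : ∀ {k l : Idx}, HasIdxT t.unfold k → HasIdxT t.unfold l →
            (iter n).1 t.unfold k l ∈ annT t.unfold := ihm hu
          exact Submodule.add_mem _ (Submodule.add_mem _ (Submodule.add_mem _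
            (foldA_mem (hb hi hj))
            (foldA_mem (bilinExt_mem (ofSet_recIdx_mem hτ hτ hi.fold) (single_mem_annT hj)
              fun _ _ => hb)))
            (foldA_mem (bilinExt_mem (single_mem_annT hi) (ofSet_recIdx_mem hτ hτ hj.fold)
              fun _ _ => hb)))
            (foldA_mem (ihN hτ hτ hi.fold hj.fold))
    · intro τ σ i j hτ hσ hi hj
      cases σ with
      | var n => exact Submodule.zero_mem _
      | top => exact Submodule.zero_mem _
      | unit => exact Submodule.zero_mem _
      | arrow => exact Submodule.zero_mem _
      | sum a b =>
        exact Submodule.add_mem _ (inlA_mem (ihN hτ hσ.1 hi hj)) (inrA_mem (ihN hτ hσ.2 hi hj))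
      | prod a b =>
        exact Submodule.add_mem _ (Submodule.add_mem _ (Submodule.add_mem _
          (pairA_mem (ihN hτ hσ.1 hi hj) (ofSet_constIdx_mem τ hσ.2))
          (pairA_mem (ofSet_constIdx_mem τ hσ.1) (ihN hτ hσ.2 hi hj)))
          (pairA_mem (ofSet_recIdx_mem hσ.1 hτ hi) (ofSet_recIdx_mem hσ.2 hτ hj)))
          (pairA_mem (ofSet_recIdx_mem hσ.1 hτ hj) (ofSet_recIdx_mem hσ.2 hτ hi))
      | mu s =>
        have h₀ : (s.inst 0 top).Closed 1 := Closed.inst good_top.1 hσ (Nat.zero_le _)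
        have h₁ : (s.inst 1 (mu τ)).Closed 1 := Closed.inst (good_mu hτ).1 hσ le_rfl
        have hu : (s.inst 1 (mu τ)).unfold.Closed 0 := Closed.inst (good_mu h₁).1 h₁ le_rfl
        have hMi := inst_top_mem hσ hτ (ofSet_recIdx_mem h₀ hτ hi)
        have hMj := inst_top_mem hσ hτ (ofSet_recIdx_mem h₀ hτ hj)
        exact Submodule.add_mem _ (Submodule.add_mem _ (Submodule.add_mem _
          (foldA_mem (inst_top_mem hσ hτ (ihN hτ h₀ hi hj)))
          (foldA_mem (bilinExt_mem (recA_mem h₁ h₁ (foldA_mem hMi)) hMj fun _ _ => ihm hu)))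
          (foldA_mem (bilinExt_mem hMi (recA_mem h₁ h₁ (foldA_mem hMj)) fun _ _ => ihm hu)))
          (foldA_mem (bilinExt_mem (foldA_mem hMi) (foldA_mem hMj) fun _ _ => ihN h₁ h₁))

theorem merge_mem {τ : Ty} {i j : Idx} (hτ : τ.Closed 0) (hi : HasIdxT τ i)
    (hj : HasIdxT τ j) : merge τ i j ∈ annT τ := by
  obtain ⟨n, hn⟩ := (mergeStable hτ i j).1.exists
  exact hn ▸ (iter_mem n).1 hτ hi hj

theorem two_mem {τ σ : Ty} {i j : Idx} (hτ : τ.Closed 1) (hσ : σ.Closed 1)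
    (hi : HasIdxT (.mu τ) i) (hj : HasIdxT (.mu τ) j) :
    two τ σ i j ∈ annT (σ.inst 0 (.mu τ)) := by
  obtain ⟨n, hn⟩ := (twoStable hτ hσ i j).1.exists
  exact hn ▸ (iter_mem n).2 hτ hσ hi hj

/-! ### Linear extensions of evaluation and index sets -/

/-- `potential` for types with `⊤_μ`, as a linear map. -/
noncomputable def Psi (τ : Ty) (v : Val) : Ann →ₗ[ℚ≥0] ℚ≥0 :=
  Finsupp.linearCombination ℚ≥0 (psi v τ)

@[simp] theorem Psi_single (τ : Ty) (v : Val) (i : Idx) (c : ℚ≥0) :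
    Psi τ v (.single i c) = c * psi v τ i := by
  simp [Psi]

theorem lin_ext {M : Type*} [AddCommMonoid M] [Module ℚ≥0 M] {F G : Ann →ₗ[ℚ≥0] M}
    (h : ∀ i, F (.single i 1) = G (.single i 1)) : F = G :=
  Finsupp.lhom_ext' fun i => LinearMap.ext_ring (h i)

theorem lin_eqOn {M : Type*} [AddCommMonoid M] [Module ℚ≥0 M] {F G : Ann →ₗ[ℚ≥0] M} {τ : Ty}
    (h : ∀ i, HasIdxT τ i → F (.single i 1) = G (.single i 1)) {P : Ann} (hP : P ∈ annT τ) :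
    F P = G P := by
  rw [annT, Finsupp.supported_eq_span_single] at hP
  refine LinearMap.eqOn_span ?_ hP
  rintro _ ⟨i, hi, rfl⟩
  exact h i hi

theorem bilin_ext {M : Type*} [AddCommMonoid M] [Module ℚ≥0 M] {F G : Ann →ₗ[ℚ≥0] Ann →ₗ[ℚ≥0] M}
    (h : ∀ i j, F (.single i 1) (.single j 1) = G (.single i 1) (.single j 1)) : F = G :=
  lin_ext fun i => lin_ext fun j => h i j

theorem bilin_eqOn {M : Type*} [AddCommMonoid M] [Module ℚ≥0 M]
    {F G : Ann →ₗ[ℚ≥0] Ann →ₗ[ℚ≥0] M} {τ ρ : Ty}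
    (h : ∀ i j, HasIdxT τ i → HasIdxT ρ j →
      F (.single i 1) (.single j 1) = G (.single i 1) (.single j 1)) {P Q : Ann}
    (hP : P ∈ annT τ) (hQ : Q ∈ annT ρ) : F P Q = G P Q :=
  lin_eqOn (F := F.flip Q) (G := G.flip Q)
    (fun i hi => lin_eqOn (F := F (.single i 1)) (G := G (.single i 1)) (fun j hj => h i j hi hj) hQ)
    hP

@[simp] theorem inlA_single (i : Idx) (c : ℚ≥0) : inlA (.single i c) = .single (.inl i) c := by
  simp [inlA]

@[simp] theorem inrA_single (i : Idx) (c : ℚ≥0) : inrA (.single i c) = .single (.inr i) c := by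
  simp [inrA]

@[simp] theorem foldA_single (i : Idx) (c : ℚ≥0) : foldA (.single i c) = .single (.fold i) c := by
  simp [foldA]

@[simp] theorem pairA_single (i j : Idx) (c d : ℚ≥0) :
    pairA (.single i c) (.single j d) = .single (.pair i j) (c * d) := by
  simp [pairA]

@[simp] theorem recA_single (τ : Ty) (i : Idx) (c : ℚ≥0) :
    recA τ (.single i c) = c • ofSet (recIdx τ i) := by
  simp [recA]

theorem Psi_inl_inlA (a b : Ty) (v : Val) (P : Ann) :
    Psi (.sum a b) (.inl v) (inlA P) = Psi a v P := by
  have : Psi (.sum a b) (.inl v) ∘ₗ inlA = Psi a v := lin_ext fun i => by simp [psi]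
  exact LinearMap.congr_fun this P

theorem Psi_inl_inrA (a b : Ty) (v : Val) (P : Ann) :
    Psi (.sum a b) (.inl v) (inrA P) = 0 := by
  have : Psi (.sum a b) (.inl v) ∘ₗ inrA = 0 := lin_ext fun i => by simp [psi]
  exact LinearMap.congr_fun this P

theorem Psi_inr_inlA (a b : Ty) (v : Val) (P : Ann) :
    Psi (.sum a b) (.inr v) (inlA P) = 0 := by
  have : Psi (.sum a b) (.inr v) ∘ₗ inlA = 0 := lin_ext fun i => by simp [psi]
  exact LinearMap.congr_fun this P

theorem Psi_inr_inrA (a b : Ty) (v : Val) (P : Ann) :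
    Psi (.sum a b) (.inr v) (inrA P) = Psi b v P := by
  have : Psi (.sum a b) (.inr v) ∘ₗ inrA = Psi b v := lin_ext fun i => by simp [psi]
  exact LinearMap.congr_fun this P

theorem Psi_pairA (a b : Ty) (v w : Val) (P Q : Ann) :
    Psi (.prod a b) (.pair v w) (pairA P Q) = Psi a v P * Psi b w Q := by
  have : pairA.compr₂ (Psi (.prod a b) (.pair v w)) =
      (LinearMap.mul ℚ≥0 ℚ≥0).compl₁₂ (Psi a v) (Psi b w) :=
    bilin_ext fun i j => by simp [psi]
  exact LinearMap.congr_fun₂ this P Q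

theorem Psi_ofSet (τ : Ty) (v : Val) (B : Finset Idx) :
    Psi τ v (ofSet B) = ∑ k ∈ B, psi v τ k := by
  simp [ofSet]

theorem Psi_foldA (t : Ty) (v : Val) (P : Ann) :
    Psi (.mu t) (.fold v) (foldA P) = Psi t.unfold v P + Psi t.unfold v (recA t (foldA P)) := by
  have : Psi (.mu t) (.fold v) ∘ₗ foldA = Psi t.unfold v + Psi t.unfold v ∘ₗ recA t ∘ₗ foldA :=
    lin_ext fun i => by simp [psi, Psi_ofSet]
  exact LinearMap.congr_fun this P

theorem ofSet_image {f : Idx → Idx} (hf : Function.Injective f) (B : Finset Idx) :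
    ofSet (B.image f) = linExt (fun i => .single (f i) 1) (ofSet B) := by
  simp [ofSet, Finset.sum_image hf.injOn]

theorem ofSet_union {B C : Finset Idx} (h : Disjoint B C) : ofSet (B ∪ C) = ofSet B + ofSet C :=
  Finset.sum_union h

theorem ofSet_pair (B C : Finset Idx) :
    ofSet ((B ×ˢ C).image fun p => .pair p.1 p.2) = pairA (ofSet B) (ofSet C) := by
  have hf : Function.Injective fun p : Idx × Idx => Idx.pair p.1 p.2 := by
    rintro ⟨i, j⟩ ⟨i', j'⟩ h
    simpa using h
  simpa [ofSet, Finset.sum_image hf.injOn, Finset.sum_product] using Finset.sum_comm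

theorem ofSet_inl_union_inr (B C : Finset Idx) :
    ofSet (B.image .inl ∪ C.image .inr) = inlA (ofSet B) + inrA (ofSet C) := by
  rw [ofSet_union, ofSet_image fun _ _ h => by simpa using h,
    ofSet_image fun _ _ h => by simpa using h]
  · rfl
  · rw [Finset.disjoint_left]
    intro k hk hk'
    simp at hk hk'
    obtain ⟨_, _, rfl⟩ := hk
    simp at hk'

/-- The index contains a `fold`. -/
def Idx.HasFold : Idx → Prop
  | fold _ => True
  | pair i j => i.HasFold ∨ j.HasFold
  | inl i => i.HasFold
  | inr i => i.HasFold
  | _ => False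

theorem not_hasFold_of_mem_constIdx {σ : Ty} {k : Idx} (hk : k ∈ constIdx σ) : ¬ k.HasFold := by
  induction σ generalizing k with
  | prod a b iha ihb =>
    simp [constIdx] at hk
    obtain ⟨i, j, ⟨hi, hj⟩, rfl⟩ := hk
    simp [Idx.HasFold, iha hi, ihb hj]
  | sum a b iha ihb =>
    simp [constIdx] at hk
    rcases hk with ⟨i, hi, rfl⟩ | ⟨i, hi, rfl⟩
    · simpa only [Idx.HasFold] using iha hi
    · simpa only [Idx.HasFold] using ihb hi
  | _ => simp [constIdx] at hk; subst hk; simp [Idx.HasFold]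

theorem hasFold_of_mem_recIdx {σ : Ty} {i k : Idx} (hi : i.HasFold) (hk : k ∈ recIdx σ i) :
    k.HasFold := by
  induction σ generalizing k with
  | var n =>
    cases n with
    | zero => simp [recIdx] at hk; exact hk ▸ hi
    | succ n => simp [recIdx] at hk
  | prod a b iha ihb =>
    simp [recIdx] at hk
    rcases hk with ⟨i, j, ⟨hi, hj⟩, rfl⟩ | ⟨i, j, ⟨hi, hj⟩, rfl⟩
    · exact .inl (iha hi)
    · exact .inr (ihb hj)
  | sum a b iha ihb =>
    simp [recIdx] at hk
    rcases hk with ⟨i, hi, rfl⟩ | ⟨i, hi, rfl⟩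
    · simpa only [Idx.HasFold] using iha hi
    · simpa only [Idx.HasFold] using ihb hi
  | mu s => simp [recIdx] at hk; obtain ⟨k, -, rfl⟩ := hk; trivial
  | _ => simp [recIdx] at hk

/-- A union of index sets becomes a sum of annotations only if it is disjoint. Here it is, because a
planted `fold` is present in `recIdx` and absent from `constIdx`; hence the restriction to arguments
`foldA P`. -/
theorem recA_prod (a b : Ty) (P : Ann) :
    recA (.prod a b) (foldA P) = pairA (recA a (foldA P)) (ofSet (constIdx b)) +
      pairA (ofSet (constIdx a)) (recA b (foldA P)) := by
  have : recA (.prod a b) ∘ₗ foldA = pairA.flip (ofSet (constIdx b)) ∘ₗ recA a ∘ₗ foldA +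
      pairA (ofSet (constIdx a)) ∘ₗ recA b ∘ₗ foldA := by
    refine lin_ext fun i => ?_
    simp only [LinearMap.comp_apply, LinearMap.add_apply, LinearMap.flip_apply, foldA_single,
      recA_single, one_smul]
    rw [recIdx, ofSet_union, ofSet_pair, ofSet_pair]
    rw [Finset.disjoint_left]
    intro k hk hk'
    simp at hk hk'
    obtain ⟨k₁, k₂, ⟨h, -⟩, rfl⟩ := hk
    obtain ⟨l₁, l₂, ⟨h', -⟩, e⟩ := hk'
    obtain ⟨rfl, -⟩ := Idx.pair.inj e
    exact not_hasFold_of_mem_constIdx h' (hasFold_of_mem_recIdx (i := .fold i) trivial h)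
  exact LinearMap.congr_fun this P

theorem recA_sum (a b : Ty) (P : Ann) :
    recA (.sum a b) P = inlA (recA a P) + inrA (recA b P) := by
  have : recA (.sum a b) = inlA ∘ₗ recA a + inrA ∘ₗ recA b :=
    lin_ext fun i => by simp [recIdx, ofSet_inl_union_inr]
  exact LinearMap.congr_fun this P

theorem recA_mu (s : Ty) (P : Ann) : recA (.mu s) P = foldA (recA (s.inst 0 .top) P) := by
  have : recA (.mu s) = foldA ∘ₗ recA (s.inst 0 .top) := by
    refine lin_ext fun i => ?_
    simp only [LinearMap.comp_apply, recA_single, one_smul]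
    rw [recIdx, ofSet_image fun _ _ h => by simpa using h]
    rfl
  exact LinearMap.congr_fun this P

theorem recA_var_zero (P : Ann) : recA (.var 0) P = P := by
  have : recA (.var 0) = LinearMap.id := lin_ext fun i => by simp [recIdx, ofSet]
  exact LinearMap.congr_fun this P

theorem recA_eq_zero {σ : Ty} (h : σ.Closed 0) (P : Ann) : recA σ P = 0 := by
  have : recA σ = 0 := lin_ext fun i => by simp [recIdx_closed h, ofSet]
  exact LinearMap.congr_fun this P

theorem recA_arrow (a b : Ty) (Θ Θcf : Set (Ann × Ann)) (P : Ann) :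
    recA (.arrow a b Θ Θcf) P = 0 := by
  have : recA (.arrow a b Θ Θcf) = 0 := lin_ext fun i => by simp [recIdx, ofSet]
  exact LinearMap.congr_fun this P

/-! ### The equations for merge and `𝒩` in linear form -/

theorem merge_fold {t : Ty} (ht : t.Closed 1) (P Q : Ann) :
    bilinExt (merge (.mu t)) (foldA P) (foldA Q) =
      foldA (bilinExt (merge t.unfold) P Q +
        bilinExt (merge t.unfold) (recA t (foldA P)) Q +
        bilinExt (merge t.unfold) P (recA t (foldA Q)) +
        bilinExt (two t t) (foldA P) (foldA Q)) := by
  have : (bilinExt (merge (.mu t))).compl₁₂ foldA foldA =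
      (bilinExt (merge t.unfold) + (bilinExt (merge t.unfold)).compl₁₂ (recA t ∘ₗ foldA) .id +
        (bilinExt (merge t.unfold)).compl₁₂ .id (recA t ∘ₗ foldA) +
        (bilinExt (two t t)).compl₁₂ foldA foldA).compr₂ foldA := by
    refine bilin_ext fun i j => ?_
    have h := (mergeStable (τ := .mu t) ht (.fold i) (.fold j)).2
    simp [h, mergeRhs]
  exact LinearMap.congr_fun₂ this P Q

theorem two_mu {τ s : Ty} (hτ : τ.Closed 1) (hs : s.Closed 2) (i j : Idx) :
    two τ (.mu s) (.fold i) (.fold j) =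
      foldA (two τ (s.inst 0 .top) (.fold i) (.fold j)) +
      foldA (bilinExt (merge (s.inst 1 (.mu τ)).unfold)
        (recA (s.inst 1 (.mu τ)) (foldA (recA (s.inst 0 .top) (foldA (.single i 1)))))
        (recA (s.inst 0 .top) (foldA (.single j 1)))) +
      foldA (bilinExt (merge (s.inst 1 (.mu τ)).unfold)
        (recA (s.inst 0 .top) (foldA (.single i 1)))
        (recA (s.inst 1 (.mu τ)) (foldA (recA (s.inst 0 .top) (foldA (.single j 1)))))) +
      foldA (bilinExt (two (s.inst 1 (.mu τ)) (s.inst 1 (.mu τ)))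
        (foldA (recA (s.inst 0 .top) (foldA (.single i 1))))
        (foldA (recA (s.inst 0 .top) (foldA (.single j 1))))) := by
  have h := (twoStable hτ (σ := .mu s) hs (.fold i) (.fold j)).2
  simpa [twoRhs] using h

/-- Exactly one constant index has the injections of the given value; it evaluates to 1 and the
others to 0. -/
theorem Psi_constIdx {σ τ : Ty} (hσ : σ.Closed 1) {v : Val}
    (hv : HasValT (σ.inst 0 (.mu τ)) v) :
    Psi (σ.inst 0 (.mu τ)) v (ofSet (constIdx σ)) = 1 := by
  induction σ generalizing v with
  | var n =>
    obtain rfl : n = 0 := by simpa [Closed] using hσ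
    cases hv
    simp [constIdx, Psi_ofSet, psi, inst]
  | top => cases hv; simp [constIdx, Psi_ofSet, psi, inst]
  | unit => cases hv; simp [constIdx, Psi_ofSet, psi, inst]
  | arrow => cases hv; simp [constIdx, Psi_ofSet, psi, inst]
  | mu => cases hv; simp [constIdx, Psi_ofSet, psi, inst]
  | prod a b iha ihb =>
    cases hv with
    | pair hv hw =>
      rw [constIdx, ofSet_pair, inst, Psi_pairA, iha hσ.1 hv, ihb hσ.2 hw, one_mul]
  | sum a b iha ihb =>
    rw [constIdx, ofSet_inl_union_inr, inst, map_add]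
    cases hv with
    | inl hv => rw [Psi_inl_inlA, Psi_inl_inrA, iha hσ.1 hv, add_zero]
    | inr hv => rw [Psi_inr_inlA, Psi_inr_inrA, ihb hσ.2 hv, zero_add]

theorem Psi_inst_top {s τ : Ty} (hs : s.Closed 2) (hτ : τ.Closed 1) (v : Val) {P : Ann}
    (h : P ∈ annT ((s.inst 0 .top).inst 0 (.mu τ))) :
    Psi (s.inst 1 (.mu τ)).unfold v P = Psi ((s.inst 0 .top).inst 0 (.mu τ)) v P :=
  lin_eqOn (fun i hi => by simpa using psi_inst_top hs hτ v hi) h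

/-! ### Sharing preserves potential -/

/-- By `Psi_foldA`, the potential of `foldA X` at `fold u` is that of `X` at `u` plus that of the
copies of `foldA X` planted in `u`. Unwinding this evaluates `X` at strictly smaller values only.
The second claim treats the planted copies for an arbitrary context `σ`. -/
theorem Psi_fold_congr (v : Val) :
    (∀ {t : Ty} {X Y : Ann}, t.Closed 1 → HasValT (.mu t) v → X ∈ annT t.unfold →
      Y ∈ annT t.unfold →
      (∀ w, sizeOf w < sizeOf v → HasValT t.unfold w → Psi t.unfold w X = Psi t.unfold w Y) →
      Psi (.mu t) v (foldA X) = Psi (.mu t) v (foldA Y)) ∧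
    (∀ {τ σ : Ty} {X Y : Ann}, τ.Closed 1 → σ.Closed 1 → HasValT (σ.inst 0 (.mu τ)) v →
      X ∈ annT τ.unfold → Y ∈ annT τ.unfold →
      (∀ w, sizeOf w ≤ sizeOf v → HasValT (.mu τ) w →
        Psi (.mu τ) w (foldA X) = Psi (.mu τ) w (foldA Y)) →
      Psi (σ.inst 0 (.mu τ)) v (recA σ (foldA X)) =
        Psi (σ.inst 0 (.mu τ)) v (recA σ (foldA Y))) := by
  induction hn : sizeOf v using Nat.strong_induction_on generalizing v with
  | _ n ih =>
  subst hn
  -- The first claim is isolated because the case `mu s` of the second uses it at the same value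
  -- `v`.
  have g₁ : ∀ {t : Ty} {X Y : Ann}, t.Closed 1 → HasValT (.mu t) v → X ∈ annT t.unfold →
      Y ∈ annT t.unfold →
      (∀ w, sizeOf w < sizeOf v → HasValT t.unfold w → Psi t.unfold w X = Psi t.unfold w Y) →
      Psi (.mu t) v (foldA X) = Psi (.mu t) v (foldA Y) := by
    intro t X Y ht hv hX hY h
    cases hv with
    | @fold _ u hu =>
      simp only [Val.fold.sizeOf_spec] at ih h
      rw [Psi_foldA, Psi_foldA, h u (by omega) hu]
      congr 1
      refine (ih _ (by omega) u rfl).2 ht ht hu hX hY fun w hw hw' => ?_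
      exact (ih _ (by omega) w rfl).1 ht hw' hX hY fun w' hw' => h w' (by omega)
  refine ⟨g₁, ?_⟩
  intro τ σ X Y hτ hσ hv hX hY h
  cases σ with
  | var n =>
    obtain rfl : n = 0 := by simpa [Closed] using hσ
    rw [recA_var_zero, recA_var_zero]
    exact h v le_rfl hv
  | top => rw [recA_eq_zero (σ := .top) trivial, recA_eq_zero (σ := .top) trivial]
  | unit => rw [recA_eq_zero (σ := .unit) trivial, recA_eq_zero (σ := .unit) trivial]
  | arrow a b Θ Θcf => rw [recA_arrow, recA_arrow]
  | prod a b =>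
    rw [recA_prod, recA_prod, inst, map_add, map_add]
    cases hv with
    | pair hv hw =>
      simp only [Val.pair.sizeOf_spec] at ih h
      simp only [Psi_pairA]
      rw [(ih _ (by omega) _ rfl).2 hτ hσ.1 hv hX hY fun w hw => h w (by omega),
        (ih _ (by omega) _ rfl).2 hτ hσ.2 hw hX hY fun w hw => h w (by omega)]
  | sum a b =>
    rw [recA_sum, recA_sum, inst, map_add, map_add]
    cases hv with
    | inl hv =>
      simp only [Val.inl.sizeOf_spec] at ih h
      simp only [Psi_inl_inlA, Psi_inl_inrA]
      rw [(ih _ (by omega) _ rfl).2 hτ hσ.1 hv hX hY fun w hw => h w (by omega)]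
    | inr hv =>
      simp only [Val.inr.sizeOf_spec] at ih h
      simp only [Psi_inr_inlA, Psi_inr_inrA]
      rw [(ih _ (by omega) _ rfl).2 hτ hσ.2 hv hX hY fun w hw => h w (by omega)]
  | mu s =>
    have h₀ : (s.inst 0 top).Closed 1 := Closed.inst good_top.1 hσ (Nat.zero_le _)
    have h₁ : (s.inst 1 (mu τ)).Closed 1 := Closed.inst (good_mu hτ).1 hσ le_rfl
    have hX' := recA_mem h₀ hτ (foldA_mem hX)
    have hY' := recA_mem h₀ hτ (foldA_mem hY)
    rw [recA_mu, recA_mu]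
    refine g₁ h₁ hv (inst_top_mem hσ hτ hX') (inst_top_mem hσ hτ hY') fun w hw hw' => ?_
    rw [Psi_inst_top hσ hτ w hX', Psi_inst_top hσ hτ w hY']
    exact (ih _ hw w rfl).2 hτ h₀ (hw'.inst_top hσ hτ) hX hY fun w' hw' => h w' (by omega)

/-- Merging preserves the potential of `v`. -/
def MergeAt (v : Val) : Prop :=
  ∀ ⦃τ : Ty⦄ ⦃i j : Idx⦄, τ.Closed 0 → HasValT τ v → HasIdxT τ i → HasIdxT τ j →
    psi v τ i * psi v τ j = Psi τ v (merge τ i j)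

/-- Pairs of occurrences of `α` in `v` are pairs of different occurrences or single occurrences. -/
def TwoAt (v : Val) : Prop :=
  ∀ ⦃τ σ : Ty⦄ ⦃i j : Idx⦄, τ.Closed 1 → σ.Closed 1 → HasValT (σ.inst 0 (.mu τ)) v →
    HasIdxT τ.unfold i → HasIdxT τ.unfold j →
    Psi (σ.inst 0 (.mu τ)) v (recA σ (foldA (.single i 1))) *
      Psi (σ.inst 0 (.mu τ)) v (recA σ (foldA (.single j 1))) =
    Psi (σ.inst 0 (.mu τ)) v (two τ σ (.fold i) (.fold j)) +
      Psi (σ.inst 0 (.mu τ)) v (recA σ (merge (.mu τ) (.fold i) (.fold j)))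

theorem MergeAt.bilin {v : Val} (h : MergeAt v) {τ : Ty} (hτ : τ.Closed 0) (hv : HasValT τ v)
    {P Q : Ann} (hP : P ∈ annT τ) (hQ : Q ∈ annT τ) :
    Psi τ v P * Psi τ v Q = Psi τ v (bilinExt (merge τ) P Q) :=
  bilin_eqOn (F := (LinearMap.mul ℚ≥0 ℚ≥0).compl₁₂ (Psi τ v) (Psi τ v))
    (G := (bilinExt (merge τ)).compr₂ (Psi τ v))
    (fun i j hi hj => by simpa using h hτ hv hi hj) hP hQ

theorem merge_fold_fold {t : Ty} (ht : t.Closed 1) (i j : Idx) :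
    merge (.mu t) (.fold i) (.fold j) =
      foldA (merge t.unfold i j +
        bilinExt (merge t.unfold) (recA t (foldA (.single i 1))) (.single j 1) +
        bilinExt (merge t.unfold) (.single i 1) (recA t (foldA (.single j 1))) +
        two t t (.fold i) (.fold j)) := by
  simpa using merge_fold ht (.single i 1) (.single j 1)

theorem mergeAt_of_lt {v : Val} (hm : ∀ w, sizeOf w < sizeOf v → MergeAt w)
    (hN : ∀ w, sizeOf w < sizeOf v → TwoAt w) : MergeAt v := by
  intro τ i j hτ hv hi hj
  rw [(mergeStable hτ i j).2]
  cases hv with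
  | tt => cases hi; cases hj; simp [mergeRhs, psi]
  | func => cases hi; cases hj; simp [mergeRhs, psi]
  | top => cases hi; cases hj; simp [mergeRhs, psi]
  | @pair a b v w hv hw =>
    cases hi with
    | pair hi₁ hi₂ =>
      cases hj with
      | pair hj₁ hj₂ =>
        simp only [Val.pair.sizeOf_spec] at hm
        simp only [mergeRhs, psi, Psi_pairA]
        rw [← hm v (by omega) hτ.1 hv hi₁ hj₁, ← hm w (by omega) hτ.2 hw hi₂ hj₂]
        ring
  | @inl a b v hv =>
    simp only [Val.inl.sizeOf_spec] at hm
    cases hi with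
    | inl hi =>
      cases hj with
      | inl hj => simp only [mergeRhs, psi, Psi_inl_inlA]; exact hm v (by omega) hτ.1 hv hi hj
      | inr hj => simp [mergeRhs, psi]
    | inr hi =>
      cases hj with
      | inl hj => simp [mergeRhs, psi]
      | inr hj => simp [mergeRhs, psi, Psi_inl_inrA]
  | @inr a b v hv =>
    simp only [Val.inr.sizeOf_spec] at hm
    cases hi with
    | inr hi =>
      cases hj with
      | inr hj => simp only [mergeRhs, psi, Psi_inr_inrA]; exact hm v (by omega) hτ.2 hv hi hj
      | inl hj => simp [mergeRhs, psi]
    | inl hi =>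
      cases hj with
      | inr hj => simp [mergeRhs, psi]
      | inl hj => simp [mergeRhs, psi, Psi_inr_inlA]
  | @fold t v hv =>
    cases hi with
    | ending => cases hj <;> simp [mergeRhs, psi]
    | @fold _ i hi =>
      cases hj with
      | ending => simp [mergeRhs, psi]
      | @fold _ j hj =>
        have hu : t.unfold.Closed 0 := Closed.inst (u := mu t) hτ hτ le_rfl
        have hMi := recA_mem hτ hτ (foldA_mem (single_mem_annT hi))
        have hMj := recA_mem hτ hτ (foldA_mem (single_mem_annT hj))
        have hmv := hm v (by simp)
        have e₁ := hmv hu hv hi hj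
        have e₂ := hmv.bilin hu hv hMi (single_mem_annT hj)
        have e₃ := hmv.bilin hu hv (single_mem_annT hi) hMj
        have e₄ := hN v (by simp) hτ hτ hv hi hj
        have hp : ∀ i, psi (.fold v) (.mu t) (.fold i) =
            psi v t.unfold i + Psi t.unfold v (recA t (foldA (.single i 1))) := by
          intro i
          simpa using Psi_foldA t v (.single i 1)
        -- `merge_fold_fold` is used forwards to expose a `foldA` for `Psi_foldA`, then backwards so
        -- that the argument of `recA` is again the merge in `e₄`.
        rw [← (mergeStable (τ := .mu t) hτ (.fold i) (.fold j)).2, hp, hp, merge_fold_fold hτ,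
          Psi_foldA, ← merge_fold_fold hτ]
        simp only [map_add]
        rw [← e₁, ← e₂, ← e₃]
        change _ * _ = Psi t.unfold v _ + Psi t.unfold v _ at e₄
        rw [add_assoc _ (Psi t.unfold v (two t t (.fold i) (.fold j))), ← e₄]
        simp only [Psi_single, one_mul]
        change (_ + Psi t.unfold v _) * (_ + Psi t.unfold v _) =
          _ + _ + _ + Psi t.unfold v _ * Psi t.unfold v _
        ring

theorem twoAt_of_le {v : Val} (hmv : MergeAt v) (hm : ∀ w, sizeOf w < sizeOf v → MergeAt w)
    (hN : ∀ w, sizeOf w < sizeOf v → TwoAt w) : TwoAt v := by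
  intro τ σ i j hτ hσ hv hi hj
  cases σ with
  | var n =>
    obtain rfl : n = 0 := by simpa [Closed] using hσ
    -- A lone `α` has no two different occurrences, so the claim is `MergeAt` at the same value.
    rw [(twoStable hτ hσ _ _).2]
    simp only [recA_var_zero, twoRhs, map_zero, zero_add]
    simpa [inst] using hmv (good_mu hτ).1 hv hi.fold hj.fold
  | top =>
    rw [(twoStable hτ hσ _ _).2]
    simp [twoRhs, recA_eq_zero (σ := .top) trivial]
  | unit =>
    rw [(twoStable hτ hσ _ _).2]
    simp [twoRhs, recA_eq_zero (σ := .unit) trivial]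
  | arrow a b Θ Θcf =>
    rw [(twoStable hτ hσ _ _).2]
    simp only [recA_arrow, twoRhs, map_zero, mul_zero, add_zero]
  | prod a b =>
    -- `recA_prod` needs its argument in the form `foldA Z`.
    obtain ⟨Z, e⟩ : ∃ Z, merge (.mu τ) (.fold i) (.fold j) = foldA Z :=
      ⟨_, merge_fold_fold hτ i j⟩
    -- The cross terms `A * B'` and `A' * B` are the summands of `𝒩` with one occurrence in each
    -- component.
    have alg : ∀ {A A' B B' N N' S S' : ℚ≥0}, A * A' = N + S → B * B' = N' + S' →
        (A + B) * (A' + B') = N + N' + A * B' + A' * B + (S + S') := by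
      intro A A' B B' N N' S S' h h'
      calc _ = A * A' + B * B' + A * B' + A' * B := by ring
        _ = _ := by rw [h, h']; ring
    rw [(twoStable hτ hσ _ _).2]
    cases hv with
    | pair hv hw =>
      simp only [Val.pair.sizeOf_spec] at hN
      have e₁ := hN _ (by omega) hτ hσ.1 hv hi hj
      have e₂ := hN _ (by omega) hτ hσ.2 hw hi hj
      have c₁ := Psi_constIdx hσ.1 hv
      have c₂ := Psi_constIdx hσ.2 hw
      have r : ∀ (σ : Ty) (i : Idx), ofSet (recIdx σ (.fold i)) = recA σ (foldA (.single i 1)) := by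
        intro σ i; simp
      rw [e] at e₁ e₂ ⊢
      simp only [recA_prod, twoRhs, inst, map_add, Psi_pairA, c₁, c₂, r, one_mul, mul_one]
      exact alg e₁ e₂
  | sum a b =>
    rw [(twoStable hτ hσ _ _).2]
    simp only [recA_sum, twoRhs, inst, map_add]
    cases hv with
    | inl hv =>
      simp only [Val.inl.sizeOf_spec] at hN
      simp only [Psi_inl_inlA, Psi_inl_inrA, add_zero]
      exact hN _ (by omega) hτ hσ.1 hv hi hj
    | inr hv =>
      simp only [Val.inr.sizeOf_spec] at hN
      simp only [Psi_inr_inlA, Psi_inr_inrA, zero_add]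
      exact hN _ (by omega) hτ hσ.2 hv hi hj
  | mu s =>
    have h₀ : (s.inst 0 top).Closed 1 := Closed.inst good_top.1 hσ (Nat.zero_le _)
    have h₁ : (s.inst 1 (mu τ)).Closed 1 := Closed.inst (good_mu hτ).1 hσ le_rfl
    have hu : (s.inst 1 (mu τ)).unfold.Closed 0 := Closed.inst (good_mu h₁).1 h₁ le_rfl
    have hMi := recA_mem h₀ hτ (foldA_mem (single_mem_annT hi))
    have hMj := recA_mem h₀ hτ (foldA_mem (single_mem_annT hj))
    have hMi' := inst_top_mem hσ hτ hMi
    have hMj' := inst_top_mem hσ hτ hMj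
    have hX₁ : two τ (s.inst 0 top) (.fold i) (.fold j) +
        recA (s.inst 0 top) (merge (.mu τ) (.fold i) (.fold j)) ∈
          annT ((s.inst 0 top).inst 0 (mu τ)) :=
      Submodule.add_mem _ (two_mem hτ h₀ hi.fold hj.fold)
        (recA_mem h₀ hτ (merge_mem (good_mu hτ).1 hi.fold hj.fold))
    -- Inside the `fold`, `TwoAt` for `s₀` at smaller values trades `ℳ_{s₀}(i) ⋎ ℳ_{s₀}(j)` for
    -- `𝒩_{s₀} + ℳ_{s₀}(fold i ⋎ fold j)`.
    have key : Psi (mu (s.inst 1 (mu τ))) v (foldA (two τ (s.inst 0 top) (.fold i) (.fold j) +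
        recA (s.inst 0 top) (merge (.mu τ) (.fold i) (.fold j)))) =
        Psi (mu (s.inst 1 (mu τ))) v (foldA (bilinExt (merge (s.inst 1 (mu τ)).unfold)
          (recA (s.inst 0 top) (foldA (.single i 1)))
          (recA (s.inst 0 top) (foldA (.single j 1))))) := by
      refine (Psi_fold_congr v).1 h₁ hv (inst_top_mem hσ hτ hX₁)
        (bilinExt_mem hMi' hMj' fun _ _ => merge_mem hu) fun w hw hw' => ?_
      rw [← (hm w hw).bilin hu hw' hMi' hMj', Psi_inst_top hσ hτ w hX₁,
        Psi_inst_top hσ hτ w hMi, Psi_inst_top hσ hτ w hMj, map_add]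
      exact (hN w hw hτ h₀ (hw'.inst_top hσ hτ) hi hj).symm
    -- Since `ℳ` at `mu s` is a `fold`, the product is one of potentials at `μβ.s₁`; expanding its
    -- merge gives the left side of `key` traded for its right side, plus the last three summands of
    -- `two_mu`.
    have main := hmv.bilin (good_mu h₁).1 hv (foldA_mem hMi') (foldA_mem hMj')
    rw [merge_fold h₁] at main
    simp only [map_add] at main key
    rw [recA_mu, recA_mu, recA_mu, two_mu hτ hσ]
    change Psi (mu (s.inst 1 (mu τ))) v _ * Psi (mu (s.inst 1 (mu τ))) v _ =
      Psi (mu (s.inst 1 (mu τ))) v _ + Psi (mu (s.inst 1 (mu τ))) v _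
    rw [main, ← key]
    simp only [map_add]
    ring

theorem mergeAt_and_twoAt (v : Val) : MergeAt v ∧ TwoAt v := by
  induction hn : sizeOf v using Nat.strong_induction_on generalizing v with
  | _ n ih =>
  subst hn
  have hm : ∀ w, sizeOf w < sizeOf v → MergeAt w := fun w hw => (ih _ hw w rfl).1
  have hN : ∀ w, sizeOf w < sizeOf v → TwoAt w := fun w hw => (ih _ hw w rfl).2
  have hmv : MergeAt v := mergeAt_of_lt hm hN
  exact ⟨hmv, twoAt_of_le hmv hm hN⟩

/-! ### Proper types -/

theorem HasVal.hasValT {τ : Ty} {v : Val} (h : HasVal τ v) : HasValT τ v := by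
  induction h with
  | tt => exact .tt
  | pair _ _ h₁ h₂ => exact .pair h₁ h₂
  | inl _ h => exact .inl h
  | inr _ h => exact .inr h
  | func => exact .func
  | fold _ h => exact .fold h

theorem HasIdx.hasIdxT {τ : Ty} {i : Idx} (h : HasIdx τ i) : HasIdxT τ i := by
  induction h with
  | tt => exact .tt
  | pair _ _ h₁ h₂ => exact .pair h₁ h₂
  | inl _ h => exact .inl h
  | inr _ h => exact .inr h
  | lam => exact .lam
  | fold _ h => exact .fold h
  | ending => exact .ending

theorem Ty.Scoped.unfold {t : Ty} (h : t.Scoped 1) : t.unfold.Scoped 0 :=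
  Scoped.inst (u := mu t) h h le_rfl

theorem HasIdxT.hasIdx {τ : Ty} {i : Idx} (h : HasIdxT τ i) (hτ : τ.IsProper) : HasIdx τ i := by
  induction h with
  | tt => exact .tt
  | pair _ _ h₁ h₂ => exact .pair (h₁ hτ.1) (h₂ hτ.2)
  | inl _ h => exact .inl (h hτ.1)
  | inr _ h => exact .inr (h hτ.2)
  | lam => exact .lam
  | fold _ h => exact .fold (h (Ty.Scoped.unfold hτ))
  | ending => exact .ending
  | top => exact hτ.elim

theorem annT_eq_annotations {τ : Ty} (hτ : τ.IsProper) : annT τ = annotations τ := by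
  have : {i | HasIdxT τ i} = {i | HasIdx τ i} :=
    Set.ext fun i => ⟨fun h => h.hasIdx hτ, fun h => h.hasIdxT⟩
  rw [annT, annotations, this]

theorem psi_eq_phi {τ : Ty} (hτ : τ.IsProper) (v : Val) (i : Idx) : psi v τ i = phi v τ i := by
  induction v generalizing τ i with
  | tt => cases τ <;> cases i <;> rfl
  | func => cases τ <;> cases i <;> rfl
  | pair v w ihv ihw =>
    cases τ with
    | prod a b =>
      cases i with
      | pair i j => simp only [psi, phi, ihv hτ.1, ihw hτ.2]
      | _ => rfl
    | _ => rfl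
  | inl v ih =>
    cases τ with
    | sum a b =>
      cases i with
      | inl i => simp only [psi, phi, ih hτ.1]
      | _ => rfl
    | _ => rfl
  | inr v ih =>
    cases τ with
    | sum a b =>
      cases i with
      | inr i => simp only [psi, phi, ih hτ.2]
      | _ => rfl
    | _ => rfl
  | fold v ih =>
    cases τ with
    | top => exact hτ.elim
    | mu t =>
      cases i with
      | fold i => simp only [psi, phi, ih (Ty.Scoped.unfold hτ)]
      | _ => rfl
    | _ => rfl

theorem potential_eq_Psi {τ : Ty} (hτ : τ.IsProper) (P : Ann) (v : Val) :
    potential τ P v = Psi τ v P := by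
  simp [potential, Psi, Finsupp.linearCombination_apply, psi_eq_phi hτ]

theorem potential_mem_resourcePolynomials {τ : Ty} {P : Ann} (hP : P ∈ annotations τ) :
    (fun v : {v : Val // HasVal τ v} => potential τ P v.1) ∈ resourcePolynomials τ := by
  have : (fun v : {v : Val // HasVal τ v} => potential τ P v.1) =
      ∑ i ∈ P.support, P i • fun v : {v : Val // HasVal τ v} => phi v.1 τ i := by
    funext v
    simp [potential, Finsupp.sum]
  rw [this]
  refine Submodule.sum_mem _ fun i hi => Submodule.smul_mem _ _ (Submodule.subset_span ⟨i, ?_, rfl⟩)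
  exact (Finsupp.mem_supported _ _).1 hP hi

end AARA

/-! ### The theorem for proper types -/

theorem mainTheorem2 (τ : AARA.Ty) (hτ : τ.IsProper) :
    -- the recursion that defines sharing on indices reaches its value after finitely many steps
    (∀ i j : AARA.Idx, AARA.HasIdx τ i → AARA.HasIdx τ j →
      ∀ᶠ n in Filter.atTop, (AARA.iter n).1 τ i j = AARA.merge τ i j) ∧
    -- sharing is an operation on annotations for `τ`, and it preserves potential
    (∀ P ∈ AARA.annotations τ, ∀ Q ∈ AARA.annotations τ,
      AARA.share τ P Q ∈ AARA.annotations τ ∧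
      ∀ v : AARA.Val, AARA.HasVal τ v →
        AARA.potential τ P v * AARA.potential τ Q v =
          AARA.potential τ (AARA.share τ P Q) v) ∧
    -- resource polynomials are closed under multiplication
    (∀ p ∈ AARA.resourcePolynomials τ, ∀ q ∈ AARA.resourcePolynomials τ,
      p * q ∈ AARA.resourcePolynomials τ) := by
  have hc : τ.Closed 0 := AARA.Ty.Scoped.closed hτ
  refine ⟨fun i j _ _ => (AARA.mergeStable hc i j).1, ?_, ?_⟩
  · rw [← AARA.annT_eq_annotations hτ]
    intro P hP Q hQ
    refine ⟨AARA.bilinExt_mem hP hQ fun _ _ => AARA.merge_mem hc, fun v hv => ?_⟩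
    simp only [AARA.potential_eq_Psi hτ]
    exact (AARA.mergeAt_and_twoAt v).1.bilin hc hv.hasValT hP hQ
  · intro p hp q hq
    induction hp using Submodule.span_induction with
    | zero => rw [zero_mul]; exact Submodule.zero_mem _
    | add p p' _ _ h h' => rw [add_mul]; exact Submodule.add_mem _ h h'
    | smul c p _ h => rw [smul_mul_assoc]; exact Submodule.smul_mem _ _ h
    | mem p hp =>
      obtain ⟨i, hi, rfl⟩ := hp
      induction hq using Submodule.span_induction with
      | zero => rw [mul_zero]; exact Submodule.zero_mem _
      | add q q' _ _ h h' => rw [mul_add]; exact Submodule.add_mem _ h h'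
      | smul c q _ h => rw [mul_smul_comm]; exact Submodule.smul_mem _ _ h
      | mem q hq =>
        obtain ⟨j, hj, rfl⟩ := hq
        have hmem : AARA.merge τ i j ∈ AARA.annotations τ := by
          rw [← AARA.annT_eq_annotations hτ]
          exact AARA.merge_mem hc hi.hasIdxT hj.hasIdxT
        convert AARA.potential_mem_resourcePolynomials hmem using 1
        funext v
        rw [AARA.potential_eq_Psi hτ, ← (AARA.mergeAt_and_twoAt v.1).1 hc v.2.hasValT hi.hasIdxT
          hj.hasIdxT, AARA.psi_eq_phi hτ, AARA.psi_eq_phi hτ]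
        rfl
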